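/- Let $n,m,p\ge 0$ be integers. Consider the problem of minimizing $f(x)$ subject to $g^{(i)}(x)\le 0$ ($i=1,\dots,m$), $Ax+b=0$, $x\in X$, where $f,g^{(i)}:\mathbb R^n\to\mathbb R$, $A\in\mathbb R^{p\times n}$, $b\in\mathbb R^p$ and $X\subseteq\mathbb R^n$ is closed and convex. All norms are Euclidean, and $\sigma_{\max}(A)=\sqrt{\lambda_{\max}(A^TA)}$ ($0$ if $A$ has a zero dimension). Put $D=\{u\in\mathbb R^{m+p}: u^{(i)}\ge 0,\ i\le m\}$, let $\mathcal P_D$ be the projection onto $D$, and $$\mathcal L(x,u)=f(x)+\sum_{i=1}^m u^{(i)}g^{(i)}(x)+(u^{(m+1:m+p)})^T(Ax+b),\qquad d(u)=\inf_{x\in X}\mathcal L(x,u),\qquad \bar x(u)=\operatorname{arg\,min}_{x\in X}\mathcal L(x,u).$$ Let $f^\star$ and $x^\star$ be the optimal value and the optimal solution of the problem, $d^\star=\sup_{u\in D}d(u)$, $D^\star$ the set of maximizers of $d$ over $D$, and $\Delta(x)=\bigl(\|Ax+b\|^2+\sum_{i=1}^m\max\{0,g^{(i)}(x)\}^2\bigr)^{1/2}$.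 Assume: 1. $f$ is lower semicontinuous on $X$ and strongly convex over $X$ with parameter $\theta>0$; 2. each $g^{(i)}$ is convex over $X$, satisfies $|g^{(i)}(x)-g^{(i)}(y)|\le L_i\|x-y\|$ for $x,y\in X$ with some $L_i>0$, and is differentiable at every point of $X$, with $\nabla g^{(i)}$ bounded on bounded subsets of $X$; 3. there is $\tilde x$ in the relative interior of $X$ with $g^{(i)}(\tilde x)<0$ for all $i$ and $A\tilde x+b=0$; 4. $m+p\ne 0$, and $A\neq 0$ if $p\ne0$; 5. $\tilde u\in\mathbb R^{m+p}$ satisfies $\tilde u^{(i)}<0$ for $i\le m$, and $\mathcal L(\cdot,\tilde u)$ is strongly convex over $X$ (with some positive parameter); 6. $\gamma(u)>0$ for all $u\in D$, where $$\gamma(u)=\frac{\sqrt{m+1}}{\theta}\max\Bigl\{\sigma_{\max}(A),\max_{1\le i\le m}\|\nabla g^{(i)}(\bar x(u))\|\Bigr\}$$ (the inner maximum is $0$ if $m=0$). Let $\tilde D=\{u: u^{(i)}\ge\tilde u^{(i)},\ i\le m\}$. For a set $S$ of dual vectors put $L(S)=\sup_{u\in S}\gamma(u)\,\bigl(\sigma_{\max}^2(A)+\sum_{i=1}^m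 L_i^2\bigr)^{1/2}$. For $S\subseteq D$ put $$\Phi(S)=\operatorname{conv}\{\mathcal P_D[u+\beta\nabla d(u)]: u\in S,\ 0\le\beta\le 1/L(S)\},\qquad s(S)=\sup_{u,v\in S}\max_{1\le i\le m}\frac{-|\nabla^{(i)}d(u)-\nabla^{(i)}d(v)|}{\tilde u^{(i)}},$$ let $\eta(S)=s(S)$ if $m\geq 1$ and $s(S)>0$, and $\eta(S)=\sigma_{\max}^2(A)/\theta$ otherwise, and let $$\Psi(S)=\operatorname{conv}\{u+\beta(\nabla d(u)-\nabla d(v)): u,v\in S,\ 0\le\beta\le 1/\eta(S)\}\ \text{ if }\eta(S)>0,\qquad \Psi(S)=S\ \text{ otherwise.}$$ Let $u^\star\in D^\star$, $u_0\in D$, $D_0=\{u\in D:\|u-u^\star\|\le\|u_0-u^\star\|\}$ and $R_0=d^\star-d(u_0)$. Then $d$ is differentiable at every point of $D$, $\Phi(D_0)\subseteq D$, $\Psi(D_0)\subseteq\tilde D$, $L(\Phi(D_0)),L(\Psi(D_0))\in(0,\infty)$, $\eta(D_0)\in[0,\infty)$, $\sup_{u\in D_0}\|\nabla d(u)\|<\infty$,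 and $R_0\in[0,\infty)$, with $R_0>0$ if $u_0\notin D^\star$. Moreover, suppose that $$0<\alpha<\begin{cases}\dfrac{2}{L(\Psi(D_0))},&\text{if }L(\Psi(D_0))>\eta(D_0),\\[2mm] 4\Bigl(\dfrac1{\eta(D_0)}-\dfrac{L(\Psi(D_0))}{2\eta(D_0)^2}\Bigr),&\text{otherwise,}\end{cases}$$ and let $u_{k+1}=\mathcal P_D[u_k+\alpha\nabla d(u_k)]$ for $k\ge0$. Put $\delta=\frac1\alpha-\frac{L(\Psi(D_0))}2$ and $\rho=\bigl(\sup_{u\in D_0}\|\nabla d(u)\|+\|u_0-u^\star\|/\alpha\bigr)^2$. Then $\delta>0$, and $\rho>0$ if $u_0\notin D^\star$; and for every $k\ge0$, with $E_k=\dfrac{R_0}{1+kR_0\delta\rho^{-1}}$ (read as $0$ if $R_0=0$), $$d^\star-d(u_k)\le E_k,\qquad \|\bar x(u_k)-x^\star\|\le\bigl(2\theta^{-1}E_k\bigr)^{1/2},$$ $$-\|u^\star\|\bigl(2L(\Phi(D_0))E_k\bigr)^{1/2}\le f(\bar x(u_k))-f^\star\le(\|u^\star\|+\|u_0-u^\star\|)\bigl(2(m+p)L(\Phi(D_0))E_k\bigr)^{1/2}+E_k,$$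 $$\Delta(\bar x(u_k))\le\bigl(2L(\Phi(D_0))E_k\bigr)^{1/2}.$$ -/

import Mathlib

open scoped InnerProductSpace

namespace DualAscent

/-- Primal space `ℝⁿ` with the Euclidean norm. -/
abbrev Vec (n : ℕ) := EuclideanSpace ℝ (Fin n)

/-- Dual space `ℝ^(m+p)` with the Euclidean norm: the coordinates `Sum.inl i` are the first `m`
entries, the coordinates `Sum.inr j` are the last `p` entries. -/
abbrev DualVec (m p : ℕ) := EuclideanSpace ℝ (Fin m ⊕ Fin p)

/-- A minimizer of `h` over `S` (an arbitrary point if there is none). -/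
noncomputable def argminOn {E : Type*} [Nonempty E] (h : E → ℝ) (S : Set E) : E :=
  Classical.epsilon fun x => x ∈ S ∧ IsMinOn h S x

/-- Euclidean projection onto `Q`. -/
noncomputable def proj {ι : Type*} [Fintype ι] (Q : Set (EuclideanSpace ℝ ι))
    (w : EuclideanSpace ℝ ι) : EuclideanSpace ℝ ι :=
  argminOn (fun y => ‖y - w‖) Q

/-- `σ_max(A) = √(λ_max(Aᵀ A))`; it is `0` when `A` has a zero dimension. -/
noncomputable def sigmaMax {p n : ℕ} (A : Matrix (Fin p) (Fin n) ℝ) : ℝ :=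
  √(⨆ i, (Matrix.isHermitian_conjTranspose_mul_self A).eigenvalues i)

/-- Data of the problem `min f(x)` subject to `g i x ≤ 0` for all `i`, `A x + b = 0`, `x ∈ X`,
with the convexity parameter `θ` of `f` and the Lipschitz constants `K i` of the `g i`. -/
structure Problem (n m p : ℕ) where
  f : Vec n → ℝ
  g : Fin m → Vec n → ℝ
  A : Matrix (Fin p) (Fin n) ℝ
  b : Vec p
  X : Set (Vec n)
  θ : ℝ
  K : Fin m → ℝ

namespace Problem

variable {n m p : ℕ} (P : Problem n m p)

/-- The residual `A x + b` of the equality constraints. -/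
noncomputable def eqRes (x : Vec n) : Vec p := Matrix.toEuclideanLin P.A x + P.b

/-- The feasible set of the primal problem. -/
def feasible : Set (Vec n) := {x | x ∈ P.X ∧ (∀ i, P.g i x ≤ 0) ∧ P.eqRes x = 0}

/-- The primal optimal value `f⋆`. -/
noncomputable def fStar : ℝ := sInf (P.f '' P.feasible)

/-- The primal optimal solution `x⋆`. -/
noncomputable def xStar : Vec n := argminOn P.f P.feasible

/-- The Lagrangian. -/
noncomputable def lagrangian (x : Vec n) (u : DualVec m p) : ℝ :=
  P.f x + ∑ i, u (Sum.inl i) * P.g i x + ∑ j, u (Sum.inr j) * P.eqRes x j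

/-- The dual function `d(u) = inf_{x ∈ X} 𝓛(x, u)`. -/
noncomputable def dual (u : DualVec m p) : ℝ := sInf ((fun x => P.lagrangian x u) '' P.X)

/-- The minimizer `x̄(u)` of `𝓛(·, u)` over `X`. -/
noncomputable def xBar (u : DualVec m p) : Vec n := argminOn (fun x => P.lagrangian x u) P.X

/-- The gradient of the dual function. -/
noncomputable def gradDual (u : DualVec m p) : DualVec m p := gradient P.dual u

end Problem

/-- The dual feasible set `D`: the first `m` entries are nonnegative. -/
def dualFeasible (m p : ℕ) : Set (DualVec m p) := {u | ∀ i, 0 ≤ u (Sum.inl i)}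

/-- The enlarged set `D̃`: the first `m` entries dominate those of `ũ`. -/
def dualFeasibleExt {m p : ℕ} (ut : DualVec m p) : Set (DualVec m p) :=
  {u | ∀ i, ut (Sum.inl i) ≤ u (Sum.inl i)}

namespace Problem

variable {n m p : ℕ} (P : Problem n m p)

/-- The dual optimal value `d⋆`. -/
noncomputable def dStar : ℝ := sSup (P.dual '' dualFeasible m p)

/-- The dual optimal set `D⋆`. -/
def dualOptimal : Set (DualVec m p) :=
  {u | u ∈ dualFeasible m p ∧ IsMaxOn P.dual (dualFeasible m p) u}

/-- The primal infeasibility `Δ(x)`. -/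
noncomputable def infeas (x : Vec n) : ℝ :=
  √(‖P.eqRes x‖ ^ 2 + ∑ i, (max 0 (P.g i x)) ^ 2)

/-- `γ(u) = √(m+1)/θ · max {σ_max(A), max_i ‖∇g_i(x̄(u))‖}`; the inner maximum is `0` if `m = 0`. -/
noncomputable def gamma (u : DualVec m p) : ℝ :=
  √((m : ℝ) + 1) / P.θ * max (sigmaMax P.A) (⨆ i, ‖gradient (P.g i) (P.xBar u)‖)

/-- `L(S) = sup_{u ∈ S} γ(u) · (σ_max(A)² + ∑ K_i²)^(1/2)`. -/
noncomputable def lipConst (S : Set (DualVec m p)) : ℝ :=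
  sSup (P.gamma '' S) * √(sigmaMax P.A ^ 2 + ∑ i, P.K i ^ 2)

/-- `Φ(S)`: convex hull of the projected gradient steps of length at most `1 / L(S)` from `S`. -/
noncomputable def Phi (S : Set (DualVec m p)) : Set (DualVec m p) :=
  convexHull ℝ {w | ∃ u ∈ S, ∃ β ∈ Set.Icc 0 (1 / P.lipConst S),
    w = proj (dualFeasible m p) (u + β • P.gradDual u)}

/-- The quotients `-|∇⁽ⁱ⁾d(u) - ∇⁽ⁱ⁾d(v)| / ũ⁽ⁱ⁾` for `u, v ∈ S`, `i ≤ m`. -/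
def etaQuotients (ut : DualVec m p) (S : Set (DualVec m p)) : Set ℝ :=
  {r | ∃ u ∈ S, ∃ v ∈ S, ∃ i : Fin m,
    r = -|P.gradDual u (Sum.inl i) - P.gradDual v (Sum.inl i)| / ut (Sum.inl i)}

open Classical in
/-- `η(S)`: the supremum of the quotients if it is positive, and `σ_max(A)² / θ` otherwise. -/
noncomputable def eta (ut : DualVec m p) (S : Set (DualVec m p)) : ℝ :=
  if 0 < sSup (P.etaQuotients ut S) then sSup (P.etaQuotients ut S)
  else sigmaMax P.A ^ 2 / P.θ

open Classical in
/-- `Ψ(S)`: convex hull of the points `u + β (∇d(u) - ∇d(v))`, `u, v ∈ S`, `0 ≤ β ≤ 1 / η(S)`, if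
`η(S) > 0`, and `S` itself otherwise. -/
noncomputable def Psi (ut : DualVec m p) (S : Set (DualVec m p)) : Set (DualVec m p) :=
  if 0 < P.eta ut S then
    convexHull ℝ {w | ∃ u ∈ S, ∃ v ∈ S, ∃ β ∈ Set.Icc 0 (1 / P.eta ut S),
      w = u + β • (P.gradDual u - P.gradDual v)}
  else S

open Classical in
/-- The upper end of the step-size range, for `L = L(Ψ(S))` and `η = η(S)`. -/
noncomputable def stepBound (ut : DualVec m p) (S : Set (DualVec m p)) : ℝ :=
  if P.lipConst (P.Psi ut S) > P.eta ut S then 2 / P.lipConst (P.Psi ut S)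
  else 4 * (1 / P.eta ut S - P.lipConst (P.Psi ut S) / (2 * P.eta ut S ^ 2))

/-- The basic assumptions on the problem: closed convex `X`, strongly convex objective, convex
Lipschitz inequality constraints, Slater's condition, nontrivial constraints. -/
structure BasicAssumptions : Prop where
  isClosed : IsClosed P.X
  convex : Convex ℝ P.X
  theta_pos : 0 < P.θ
  strongConvex : StrongConvexOn P.X P.θ P.f
  lsc : LowerSemicontinuousOn P.f P.X
  convex_g : ∀ i, ConvexOn ℝ P.X (P.g i)
  K_pos : ∀ i, 0 < P.K i
  lipschitz_g : ∀ i, ∀ x ∈ P.X, ∀ y ∈ P.X, |P.g i x - P.g i y| ≤ P.K i * ‖x - y‖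
  slater : ∃ x ∈ intrinsicInterior ℝ P.X, (∀ i, P.g i x < 0) ∧ P.eqRes x = 0
  exists_constraint : m + p ≠ 0
  A_ne_zero : p ≠ 0 → P.A ≠ 0

/-- The assumptions on the inequality constraints: every `g i` is differentiable at the points of
`X`, with a gradient bounded on bounded subsets of `X`, and `𝓛(·, ũ)` is strongly convex over `X`
for a `ũ` whose first `m` entries are negative. -/
structure ConstraintAssumptions (ut : DualVec m p) : Prop where
  differentiable_g : ∀ i, ∀ x ∈ P.X, DifferentiableAt ℝ (P.g i) x
  bounded_gradient : ∀ i, ∀ B ⊆ P.X, Bornology.IsBounded B →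
    Bornology.IsBounded (gradient (P.g i) '' B)
  ut_neg : ∀ i, ut (Sum.inl i) < 0
  strongConvex_lagrangian : ∃ μ > 0, StrongConvexOn P.X μ fun x => P.lagrangian x ut

end Problem

end DualAscent

namespace DualAscent

open Filter Topology

/-! The dual function is concave and its gradient at `u` is the vector of constraint values at
`x̄(u)`. The convergence proof is that of projected gradient ascent, except that a global Lipschitz
constant of the gradient is replaced by constants computed on sets that contain the iterates.

The central estimate is `norm_xBar_sub_le`. For `u ∈ D̃` and `v ∈ D`, the optimality condition at
`x̄(u)` involves only the gradients of the `g i` there, so the signs of `u` are irrelevant; at `v ≥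
0`, convexity replaces `g i` by the same linearization. Adding the two conditions bounds `‖x̄(u) -
x̄(v)‖` by `γ(u)‖u - v‖`, with the parameter `θ` of `f` alone.

Integrated along segments, this gives quadratic lower models of `d`. Combined with supergradient
upper bounds at points of `Ψ(D₀)`, which may leave `D` but not `D̃`, they yield the cocoercivity
inequality `gradDual_cocoercive`. Hence an admissible step never increases the distance to `u⋆`, and
every iterate remains in `D₀`.

There each step gains at least `δ‖u (k+1) - u k‖²` (`dual_clip_step_ge`), while the dual gap is at
most `√ρ ‖u (k+1) - u k‖` (`dStar_sub_le_mul_norm_clip_step`). The resulting recursion `e (k+1) ≤ e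
k - (δ/ρ) (e k)²` gives the rate `1/k`.

The primal bounds come from `primal_estimates`: a fictitious projected step of length `1/L(Φ(D₀))`
from `u k` cannot gain more than the dual gap, and its guaranteed gain controls infeasibility and
complementarity. Strong duality follows from the first-order conditions at `u⋆`. -/

theorem argminOn_spec {E : Type*} [Nonempty E] {h : E → ℝ} {S : Set E}
    (hex : ∃ x ∈ S, IsMinOn h S x) : argminOn h S ∈ S ∧ IsMinOn h S (argminOn h S) :=
  Classical.epsilon_spec (p := fun x => x ∈ S ∧ IsMinOn h S x) hex

theorem le_of_forall_one_sub_mul_le {c d : ℝ} (h : ∀ t ∈ Set.Ioo (0 : ℝ) 1, (1 - t) * c ≤ d) :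
    c ≤ d := by
  have ht : Tendsto (fun t : ℝ => (1 - t) * c) (𝓝[>] 0) (𝓝 c) := by
    have : Continuous fun t : ℝ => (1 - t) * c := by fun_prop
    simpa using (this.tendsto 0).mono_left nhdsWithin_le_nhds
  exact le_of_tendsto ht (eventually_of_mem (Ioo_mem_nhdsGT one_pos) h)

theorem le_div_of_mul_sq_le {a r t : ℝ} (hr : 0 ≤ r) (h : a * r ^ 2 ≤ t * r)
    (ht : 0 ≤ t) (ha : 0 < a) : r ≤ t / a := by
  rw [le_div_iff₀ ha]
  rcases hr.eq_or_lt with h0 | h0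
  · simpa [← h0] using ht
  · refine le_of_mul_le_mul_right ?_ h0
    linarith

/-! ### Strongly convex functions and their minimizers -/

section StrongConvexity

variable {E : Type*} [NormedAddCommGroup E] [NormedSpace ℝ E] {X : Set E} {h : E → ℝ} {μ : ℝ}

theorem StrongConvexOn.add_smul_sub_le (hh : StrongConvexOn X μ h) {x y : E} (hx : x ∈ X)
    (hy : y ∈ X) {t : ℝ} (h0 : 0 ≤ t) (h1 : t ≤ 1) :
    h (x + t • (y - x)) ≤ (1 - t) * h x + t * h y - t * (1 - t) * (μ / 2 * ‖x - y‖ ^ 2) := by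
  have := hh.2 hx hy (sub_nonneg.2 h1) h0 (by ring)
  have e : x + t • (y - x) = (1 - t) • x + t • y := by module
  simp only [smul_eq_mul] at this
  rw [e]
  linarith

/-- Quadratic growth of a strongly convex function at its minimizer. -/
theorem StrongConvexOn.quadratic_growth (hh : StrongConvexOn X μ h) {x y : E} (hx : x ∈ X)
    (hmin : IsMinOn h X x) (hy : y ∈ X) : h x + μ / 2 * ‖x - y‖ ^ 2 ≤ h y := by
  suffices μ / 2 * ‖x - y‖ ^ 2 ≤ h y - h x by linarith
  refine le_of_forall_one_sub_mul_le fun t ht => ?_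
  have h1 := StrongConvexOn.add_smul_sub_le hh hx hy ht.1.le ht.2.le
  have h2 : h x ≤ h (x + t • (y - x)) := hmin (hh.1.add_smul_sub_mem hx hy ⟨ht.1.le, ht.2.le⟩)
  refine le_of_mul_le_mul_left ?_ ht.1
  linarith

/-- A strongly convex lower semicontinuous function attains its minimum over a closed set. -/
theorem StrongConvexOn.exists_isMinOn [ProperSpace E] (hX : IsClosed X) (hne : X.Nonempty)
    (hμ : 0 < μ) (hh : StrongConvexOn X μ h) (hl : LowerSemicontinuousOn h X) :
    ∃ x ∈ X, IsMinOn h X x := by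
  obtain ⟨x₀, hx₀⟩ := hne
  have hmin : ∀ R : ℝ, 0 ≤ R → ∃ y ∈ X ∩ Metric.closedBall x₀ R,
      IsMinOn h (X ∩ Metric.closedBall x₀ R) y := fun R hR =>
    LowerSemicontinuousOn.exists_isMinOn ⟨x₀, hx₀, Metric.mem_closedBall_self hR⟩
      ((isCompact_closedBall x₀ R).inter_left hX) (hl.mono Set.inter_subset_left)
  obtain ⟨y₁, hy₁, hm₁⟩ := hmin 1 zero_le_one
  have hc : h y₁ ≤ h x₀ := hm₁ ⟨hx₀, Metric.mem_closedBall_self zero_le_one⟩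
  -- Beyond this radius, the strong convexity term along the ray from `x₀` outweighs the largest
  -- decrease `h x₀ - h y₁` possible within the unit ball.
  set R : ℝ := 1 + 2 * (h x₀ - h y₁) / μ with hR
  have hR1 : 1 ≤ R := by
    have : 0 ≤ 2 * (h x₀ - h y₁) / μ := by
      apply div_nonneg _ hμ.le
      linarith
    linarith
  obtain ⟨y, hy, hm⟩ := hmin R (by linarith)
  refine ⟨y, hy.1, fun x hx => ?_⟩
  by_cases hxR : x ∈ Metric.closedBall x₀ R
  · exact hm ⟨hx, hxR⟩
  have hyx₀ : h y ≤ h x₀ := hm ⟨hx₀, Metric.mem_closedBall_self (by linarith)⟩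
  refine hyx₀.trans ?_
  set r := ‖x₀ - x‖ with hr
  have hrR : R < r := by
    rw [Metric.mem_closedBall, dist_eq_norm, norm_sub_rev] at hxR
    exact not_le.1 hxR
  have hr0 : 0 < r := by linarith
  have hi1 : r⁻¹ ≤ 1 := inv_le_one_of_one_le₀ (by linarith)
  -- The point at distance one from `x₀` towards `x` lies in the unit ball, so its value is at least
  -- `h y₁`; this forces `h x ≥ h x₀`.
  have hz : x₀ + r⁻¹ • (x - x₀) ∈ X ∩ Metric.closedBall x₀ 1 := by
    refine ⟨hh.1.add_smul_sub_mem hx₀ hx ⟨by positivity, hi1⟩, ?_⟩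
    rw [Metric.mem_closedBall, dist_eq_norm, add_sub_cancel_left, norm_smul, norm_sub_rev, ← hr,
      Real.norm_of_nonneg (by positivity), inv_mul_cancel₀ hr0.ne']
  have h1 : h y₁ ≤ _ := (hm₁ hz).trans
    (StrongConvexOn.add_smul_sub_le hh hx₀ hx (by positivity) hi1)
  have h2 : r * h y₁ ≤ (r - 1) * h x₀ + h x - (r - 1) * (μ / 2 * r) := by
    have := mul_le_mul_of_nonneg_left h1 hr0.le
    rw [← hr] at this
    refine this.trans (le_of_eq ?_)
    field_simp
  have h3 : 2 * (h x₀ - h y₁) ≤ μ * (r - 1) := by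
    have : 2 * (h x₀ - h y₁) / μ ≤ r - 1 := by linarith
    rw [div_le_iff₀ hμ] at this
    linarith
  have h4 := mul_le_mul_of_nonneg_left h3 hr0.le
  change h x₀ ≤ h x
  linarith

end StrongConvexity

/-! ### One-sided slopes and the gradient inequality -/

section Gradient

variable {E : Type*} [NormedAddCommGroup E] [InnerProductSpace ℝ E] [CompleteSpace E]
  {X : Set E} {h : E → ℝ}

theorem tendsto_slope_gradient {x : E} (hd : DifferentiableAt ℝ h x) (v : E) :
    Tendsto (fun t : ℝ => t⁻¹ * (h (x + t • v) - h x)) (𝓝[>] 0) (𝓝 ⟪gradient h x, v⟫_ℝ) := by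
  have := (hd.hasGradientAt.hasFDerivAt.hasLineDerivAt v).tendsto_slope_zero_right
  simpa using this

theorem ConvexOn.inner_gradient_le (hc : ConvexOn ℝ X h) {x y : E} (hx : x ∈ X) (hy : y ∈ X)
    (hd : DifferentiableAt ℝ h x) : ⟪gradient h x, y - x⟫_ℝ ≤ h y - h x := by
  refine le_of_tendsto (tendsto_slope_gradient hd (y - x))
    (eventually_of_mem (Ioo_mem_nhdsGT one_pos) fun t ht => ?_)
  have := hc.2 hx hy (sub_nonneg.2 ht.2.le) ht.1.le (by ring)
  have e : x + t • (y - x) = (1 - t) • x + t • y := by module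
  simp only [smul_eq_mul] at this
  change t⁻¹ * (h (x + t • (y - x)) - h x) ≤ _
  rw [e, inv_mul_le_iff₀ ht.1]
  linarith

end Gradient

theorem sigmaMax_nonneg {p n : ℕ} (A : Matrix (Fin p) (Fin n) ℝ) : 0 ≤ sigmaMax A :=
  Real.sqrt_nonneg _

/-- In an orthonormal eigenbasis of `Aᵀ A`, the quantity `‖A x‖²` is the sum of squared coordinates
of `x` weighted by the eigenvalues. -/
theorem norm_toEuclideanLin_le {p n : ℕ} (A : Matrix (Fin p) (Fin n) ℝ) (x : Vec n) :
    ‖Matrix.toEuclideanLin A x‖ ≤ sigmaMax A * ‖x‖ := by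
  set H := Matrix.isHermitian_conjTranspose_mul_self A with hH
  have hq : ‖Matrix.toEuclideanLin A x‖ ^ 2
      = ∑ i, H.eigenvalues i * ⟪H.eigenvectorBasis i, x⟫_ℝ ^ 2 := by
    have e1 : ‖Matrix.toEuclideanLin A x‖ ^ 2
        = ⟪Matrix.toEuclideanLin (A.conjTranspose * A) x, x⟫_ℝ := by
      have : Matrix.toEuclideanLin (A.conjTranspose * A) x
          = LinearMap.adjoint (Matrix.toEuclideanLin A) (Matrix.toEuclideanLin A x) := by
        rw [← Matrix.toEuclideanLin_conjTranspose_eq_adjoint]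
        ext i
        simp [Matrix.toLpLin_apply]
      rw [this, LinearMap.adjoint_inner_left, real_inner_self_eq_norm_sq]
    rw [e1, ← H.eigenvectorBasis.sum_inner_mul_inner]
    refine Finset.sum_congr rfl fun i _ => ?_
    have hs : (Matrix.toEuclideanLin (A.conjTranspose * A)).IsSymmetric :=
      Matrix.isSymmetric_toEuclideanLin_iff.2 H
    rw [hs x]
    have : Matrix.toEuclideanLin (A.conjTranspose * A) (H.eigenvectorBasis i)
        = H.eigenvalues i • H.eigenvectorBasis i := by
      have := H.mulVec_eigenvectorBasis i
      ext j
      simpa [Matrix.toLpLin_apply] using congrFun this j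
    rw [this, real_inner_smul_right, real_inner_comm x]
    ring
  have hle : ‖Matrix.toEuclideanLin A x‖ ^ 2 ≤ (⨆ i, H.eigenvalues i) * ‖x‖ ^ 2 := by
    rw [hq, ← H.eigenvectorBasis.sum_sq_inner_right x, Finset.mul_sum]
    refine Finset.sum_le_sum fun i _ => ?_
    exact mul_le_mul_of_nonneg_right (le_ciSup (Set.finite_range _).bddAbove i) (sq_nonneg _)
  rw [← Real.sqrt_sq (norm_nonneg (Matrix.toEuclideanLin A x)), ← Real.sqrt_sq (norm_nonneg x),
    sigmaMax, ← Real.sqrt_mul' _ (sq_nonneg _)]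
  exact Real.sqrt_le_sqrt hle

theorem sigmaMax_pos {p n : ℕ} {A : Matrix (Fin p) (Fin n) ℝ} (hA : A ≠ 0) : 0 < sigmaMax A := by
  refine (sigmaMax_nonneg A).lt_of_ne fun h0 => hA ?_
  have : Matrix.toEuclideanLin A = 0 := by
    ext1 x
    have := norm_toEuclideanLin_le A x
    rw [← h0, zero_mul] at this
    simpa using this
  simpa using this

/-! ### Projection onto the dual feasible set -/

section Projection

variable {m p : ℕ}

theorem dual_inner_eq (u v : DualVec m p) :
    ⟪u, v⟫_ℝ = ∑ i, u (Sum.inl i) * v (Sum.inl i) + ∑ j, u (Sum.inr j) * v (Sum.inr j) := by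
  simp [PiLp.inner_apply, mul_comm]

theorem dual_norm_sq (u : DualVec m p) :
    ‖u‖ ^ 2 = ∑ i, u (Sum.inl i) ^ 2 + ∑ j, u (Sum.inr j) ^ 2 := by
  simp [EuclideanSpace.norm_sq_eq]

theorem convex_dualFeasible : Convex ℝ (dualFeasible m p) := by
  intro u hu v hv a b ha hb _ i
  have := mul_nonneg ha (hu i)
  have := mul_nonneg hb (hv i)
  simp
  linarith

/-- The coordinatewise description of the projection onto the dual feasible set. -/
noncomputable def clip (w : DualVec m p) : DualVec m p :=
  WithLp.toLp 2 (Sum.elim (fun i => max 0 (w (Sum.inl i))) fun j => w (Sum.inr j))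

@[simp] theorem clip_inl (w : DualVec m p) (i : Fin m) :
    clip w (Sum.inl i) = max 0 (w (Sum.inl i)) := rfl

@[simp] theorem clip_inr (w : DualVec m p) (j : Fin p) : clip w (Sum.inr j) = w (Sum.inr j) := rfl

theorem clip_mem (w : DualVec m p) : clip w ∈ dualFeasible m p := fun _ => le_max_left _ _

theorem clip_of_mem {w : DualVec m p} (hw : w ∈ dualFeasible m p) : clip w = w := by
  ext (i | j)
  · simpa using hw i
  · rfl

theorem inner_sub_clip_le (w : DualVec m p) {v : DualVec m p} (hv : v ∈ dualFeasible m p) :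
    ⟪w - clip w, v - clip w⟫_ℝ ≤ 0 := by
  rw [dual_inner_eq]
  simp only [PiLp.sub_apply, clip_inl, clip_inr, sub_self, zero_mul, Finset.sum_const_zero,
    add_zero]
  refine Finset.sum_nonpos fun i _ => ?_
  rcases le_total 0 (w (Sum.inl i)) with h | h
  · simp [h]
  · rw [max_eq_left h]
    simpa using mul_nonpos_of_nonpos_of_nonneg h (hv i)

/-- The obtuse-angle inequality for `clip w` strengthens to a Pythagorean one, which gives
minimality and uniqueness together; uniqueness identifies the point chosen by `argminOn`. -/
theorem proj_eq_clip (w : DualVec m p) : proj (dualFeasible m p) w = clip w := by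
  have key : ∀ v ∈ dualFeasible m p, ‖clip w - w‖ ^ 2 + ‖v - clip w‖ ^ 2 ≤ ‖v - w‖ ^ 2 := by
    intro v hv
    have h1 := inner_sub_clip_le w hv
    have h2 : v - w = (v - clip w) + (clip w - w) := by abel
    have h3 : ⟪v - clip w, clip w - w⟫_ℝ = - ⟪w - clip w, v - clip w⟫_ℝ := by
      rw [real_inner_comm, ← inner_neg_left, neg_sub]
    rw [h2, norm_add_sq_real, h3]
    linarith
  have hmin : IsMinOn (fun y => ‖y - w‖) (dualFeasible m p) (clip w) := fun v hv =>
    le_of_sq_le_sq (by have := key v hv; have := sq_nonneg ‖v - clip w‖; linarith) (norm_nonneg _)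
  obtain ⟨hm, hp⟩ := argminOn_spec ⟨clip w, clip_mem w, hmin⟩
  have h1 : ‖proj (dualFeasible m p) w - w‖ ≤ ‖clip w - w‖ := hp (clip_mem w)
  have h2 := key _ hm
  have h3 := pow_le_pow_left₀ (norm_nonneg _) h1 2
  change ‖clip w - w‖ ^ 2 + ‖proj (dualFeasible m p) w - clip w‖ ^ 2 ≤ _ at h2
  have h4 : ‖proj (dualFeasible m p) w - clip w‖ ^ 2 ≤ 0 := by
    have : ‖argminOn (fun y => ‖y - w‖) (dualFeasible m p) - w‖
      = ‖proj (dualFeasible m p) w - w‖ := rfl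
    rw [this] at h2
    linarith
  exact sub_eq_zero.1 (norm_eq_zero.1 (pow_eq_zero_iff two_ne_zero |>.1 (le_antisymm h4 (sq_nonneg _))))

theorem norm_clip_sub_clip_le (v w : DualVec m p) : ‖clip v - clip w‖ ≤ ‖v - w‖ := by
  refine le_of_sq_le_sq ?_ (norm_nonneg _)
  rw [dual_norm_sq, dual_norm_sq]
  refine add_le_add (Finset.sum_le_sum fun i _ => sq_le_sq.2 ?_) le_rfl
  have := abs_max_sub_max_le_abs (v (Sum.inl i)) (w (Sum.inl i)) 0
  simpa [max_comm] using this

end Projection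

theorem dualFeasible_subset_ext {m p : ℕ} {ut : DualVec m p} (h : ∀ i, ut (Sum.inl i) < 0) :
    dualFeasible m p ⊆ dualFeasibleExt ut := fun _ hu i => (h i).le.trans (hu i)

theorem convex_dualFeasibleExt {m p : ℕ} (ut : DualVec m p) : Convex ℝ (dualFeasibleExt ut) := by
  intro u hu v hv a b ha hb hab i
  have h1 := mul_le_mul_of_nonneg_left (hu i) ha
  have h2 := mul_le_mul_of_nonneg_left (hv i) hb
  have h3 : ut (Sum.inl i) = a * ut (Sum.inl i) + b * ut (Sum.inl i) := by
    rw [← add_mul, hab, one_mul]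
  simp only [PiLp.add_apply, PiLp.smul_apply, smul_eq_mul]
  linarith

/-- Strict negativity of `ut` leaves room around the boundary points of `D`, so derivatives within
`D̃` are full derivatives there. -/
theorem dualFeasibleExt_mem_nhds {m p : ℕ} {ut : DualVec m p} (h : ∀ i, ut (Sum.inl i) < 0)
    {u : DualVec m p} (hu : u ∈ dualFeasible m p) : dualFeasibleExt ut ∈ 𝓝 u := by
  have : dualFeasibleExt ut = ⋂ i : Fin m, {v : DualVec m p | ut (Sum.inl i) ≤ v (Sum.inl i)} := by
    ext v
    simp [dualFeasibleExt]
  rw [this, Filter.iInter_mem]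
  intro i
  have hc : ContinuousAt (fun v : DualVec m p => v (Sum.inl i)) u := by fun_prop
  exact hc.eventually_mem (Ici_mem_nhds ((h i).trans_le (hu i)))

theorem StrongConvexOn.add_convexOn {E : Type*} [NormedAddCommGroup E] [NormedSpace ℝ E]
    {X : Set E} {h k : E → ℝ} {μ : ℝ} (hh : StrongConvexOn X μ h) (hk : ConvexOn ℝ X k) :
    StrongConvexOn X μ fun x => h x + k x := by
  refine ⟨hh.1, fun x hx y hy a b ha hb hab => ?_⟩
  have h1 := hh.2 hx hy ha hb hab
  have h2 := hk.2 hx hy ha hb hab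
  simp only [smul_eq_mul] at *
  linarith

/-! ### The Lagrangian and its minimizers -/

namespace Problem

variable {n m p : ℕ} (P : Problem n m p)

/-- The stacked constraint values `(g(x), A x + b)`. -/
noncomputable def constr (x : Vec n) : DualVec m p :=
  WithLp.toLp 2 (Sum.elim (fun i => P.g i x) fun j => P.eqRes x j)

@[simp] theorem constr_inl (x : Vec n) (i : Fin m) : P.constr x (Sum.inl i) = P.g i x := rfl

@[simp] theorem constr_inr (x : Vec n) (j : Fin p) : P.constr x (Sum.inr j) = P.eqRes x j := rfl

theorem lagrangian_eq (x : Vec n) (u : DualVec m p) :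
    P.lagrangian x u = P.f x + ⟪u, P.constr x⟫_ℝ := by
  simp [lagrangian, dual_inner_eq, add_assoc]

/-- A Lipschitz constant of the stacked constraints. -/
noncomputable def constrLip : ℝ := √(sigmaMax P.A ^ 2 + ∑ i, P.K i ^ 2)

theorem eqRes_sub (x y : Vec n) :
    P.eqRes x - P.eqRes y = Matrix.toEuclideanLin P.A (x - y) := by
  simp [eqRes]

theorem constrLip_nonneg : 0 ≤ P.constrLip := Real.sqrt_nonneg _

variable {P}

theorem BasicAssumptions.norm_constr_sub_le (hP : P.BasicAssumptions) {x y : Vec n}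
    (hx : x ∈ P.X) (hy : y ∈ P.X) : ‖P.constr x - P.constr y‖ ≤ P.constrLip * ‖x - y‖ := by
  have h1 : ‖P.eqRes x - P.eqRes y‖ ^ 2 ≤ sigmaMax P.A ^ 2 * ‖x - y‖ ^ 2 := by
    rw [eqRes_sub, ← mul_pow]
    exact pow_le_pow_left₀ (norm_nonneg _) (norm_toEuclideanLin_le _ _) 2
  rw [EuclideanSpace.norm_sq_eq] at h1
  have h2 : ∑ i, (P.g i x - P.g i y) ^ 2 ≤ (∑ i, P.K i ^ 2) * ‖x - y‖ ^ 2 := by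
    rw [Finset.sum_mul]
    refine Finset.sum_le_sum fun i _ => ?_
    rw [← mul_pow, ← sq_abs]
    exact pow_le_pow_left₀ (abs_nonneg _) (hP.lipschitz_g i x hx y hy) 2
  refine le_of_sq_le_sq ?_ (mul_nonneg P.constrLip_nonneg (norm_nonneg _))
  rw [dual_norm_sq, mul_pow, constrLip, Real.sq_sqrt
    (add_nonneg (sq_nonneg _) (Finset.sum_nonneg fun i _ => sq_nonneg _))]
  simp only [PiLp.sub_apply, constr_inl, constr_inr, Real.norm_eq_abs, sq_abs] at h1 ⊢
  linarith

theorem BasicAssumptions.constrLip_pos (hP : P.BasicAssumptions) : 0 < P.constrLip := by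
  apply Real.sqrt_pos.2
  rcases Nat.eq_zero_or_pos m with hm | hm
  · have hp : p ≠ 0 := fun h => hP.exists_constraint (by omega)
    have := sigmaMax_pos (hP.A_ne_zero hp)
    exact add_pos_of_pos_of_nonneg (by positivity) (Finset.sum_nonneg fun i _ => sq_nonneg _)
  · have : 0 < ∑ i, P.K i ^ 2 :=
      Finset.sum_pos (fun i _ => pow_pos (hP.K_pos i) 2) ⟨⟨0, hm⟩, Finset.mem_univ _⟩
    have := sq_nonneg (sigmaMax P.A)
    linarith

theorem BasicAssumptions.nonempty (hP : P.BasicAssumptions) : P.X.Nonempty := by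
  obtain ⟨x, hx, -⟩ := hP.slater
  exact ⟨x, intrinsicInterior_subset hx⟩

theorem BasicAssumptions.convexOn_inner_constr (hP : P.BasicAssumptions) {w : DualVec m p}
    (hw : w ∈ dualFeasible m p) : ConvexOn ℝ P.X fun x => ⟪w, P.constr x⟫_ℝ := by
  refine ⟨hP.convex, fun x hx y hy a b ha hb hab => ?_⟩
  simp only [smul_eq_mul, dual_inner_eq, constr_inl, constr_inr, mul_add, Finset.mul_sum]
  rw [add_add_add_comm, ← Finset.sum_add_distrib, ← Finset.sum_add_distrib]
  refine add_le_add (Finset.sum_le_sum fun i _ => ?_) (Finset.sum_le_sum fun j _ => le_of_eq ?_)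
  · have h1 := (hP.convex_g i).2 hx hy ha hb hab
    simp only [smul_eq_mul] at h1
    have h2 := mul_le_mul_of_nonneg_left h1 (hw i)
    linarith
  · simp only [eqRes, map_add, map_smul, PiLp.add_apply, PiLp.smul_apply, smul_eq_mul]
    linear_combination (-(w (Sum.inr j) * P.b j)) * hab

theorem BasicAssumptions.lowerSemicontinuousOn_lagrangian (hP : P.BasicAssumptions)
    (u : DualVec m p) : LowerSemicontinuousOn (fun x => P.lagrangian x u) P.X := by
  have hF : ContinuousOn P.constr P.X := by
    have : LipschitzOnWith P.constrLip.toNNReal P.constr P.X := by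
      refine LipschitzOnWith.of_dist_le_mul fun x hx y hy => ?_
      rw [dist_eq_norm, dist_eq_norm, Real.coe_toNNReal _ P.constrLip_nonneg]
      exact hP.norm_constr_sub_le hx hy
    exact this.continuousOn
  have h2 : ContinuousOn (fun x => ⟪u, P.constr x⟫_ℝ) P.X := by fun_prop
  simp only [lagrangian_eq]
  exact hP.lsc.add h2.lowerSemicontinuousOn

theorem BasicAssumptions.strongConvexOn_lagrangian_of_mem (hP : P.BasicAssumptions)
    {u : DualVec m p} (hu : u ∈ dualFeasible m p) :
    StrongConvexOn P.X P.θ fun x => P.lagrangian x u := by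
  simp only [lagrangian_eq]
  exact StrongConvexOn.add_convexOn hP.strongConvex (hP.convexOn_inner_constr hu)

/-- A common convexity parameter of the Lagrangians `𝓛(·, u)` with `u ∈ D̃`. -/
theorem ConstraintAssumptions.exists_strongConvexOn (hP : P.BasicAssumptions) {ut : DualVec m p}
    (hut : P.ConstraintAssumptions ut) :
    ∃ μ > 0, ∀ u ∈ dualFeasibleExt ut, StrongConvexOn P.X μ fun x => P.lagrangian x u := by
  obtain ⟨μ, hμ, h⟩ := hut.strongConvex_lagrangian
  refine ⟨μ, hμ, fun u hu => ?_⟩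
  -- The Lagrangian at `u` is the one at `ut` plus the pairing of `u - ut` with the constraints,
  -- which is convex because `u - ut` is nonnegative on the inequality coordinates.
  have h1 : u - ut ∈ dualFeasible m p := fun i => by simpa using hu i
  have h2 := StrongConvexOn.add_convexOn h (hP.convexOn_inner_constr h1)
  refine cast (congrArg _ (funext fun x => ?_)) h2
  simp only [lagrangian_eq, inner_sub_left]
  ring

theorem BasicAssumptions.xBar_spec_of_strongConvexOn (hP : P.BasicAssumptions) {u : DualVec m p} {μ : ℝ}
    (hμ : 0 < μ) (h : StrongConvexOn P.X μ fun x => P.lagrangian x u) :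
    P.xBar u ∈ P.X ∧ IsMinOn (fun x => P.lagrangian x u) P.X (P.xBar u) :=
  argminOn_spec (StrongConvexOn.exists_isMinOn hP.isClosed hP.nonempty hμ h
    (hP.lowerSemicontinuousOn_lagrangian u))

theorem xBar_spec (hP : P.BasicAssumptions) {ut : DualVec m p} (hut : P.ConstraintAssumptions ut)
    {u : DualVec m p} (hu : u ∈ dualFeasibleExt ut) :
    P.xBar u ∈ P.X ∧ IsMinOn (fun x => P.lagrangian x u) P.X (P.xBar u) := by
  obtain ⟨μ, hμ, h⟩ := hut.exists_strongConvexOn hP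
  exact hP.xBar_spec_of_strongConvexOn hμ (h u hu)

/-! ### The dual function, its gradient and the stability of its minimizers -/

theorem isLeast_dual (hP : P.BasicAssumptions) {ut : DualVec m p}
    (hut : P.ConstraintAssumptions ut) {u : DualVec m p} (hu : u ∈ dualFeasibleExt ut) :
    IsLeast ((fun x => P.lagrangian x u) '' P.X) (P.lagrangian (P.xBar u) u) := by
  obtain ⟨h1, h2⟩ := xBar_spec hP hut hu
  refine ⟨⟨_, h1, rfl⟩, ?_⟩
  rintro _ ⟨x, hx, rfl⟩
  exact h2 hx

theorem dual_eq (hP : P.BasicAssumptions) {ut : DualVec m p} (hut : P.ConstraintAssumptions ut)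
    {u : DualVec m p} (hu : u ∈ dualFeasibleExt ut) :
    P.dual u = P.lagrangian (P.xBar u) u := (isLeast_dual hP hut hu).csInf_eq

theorem dual_le (hP : P.BasicAssumptions) {ut : DualVec m p} (hut : P.ConstraintAssumptions ut)
    {u : DualVec m p} (hu : u ∈ dualFeasibleExt ut) {x : Vec n} (hx : x ∈ P.X) :
    P.dual u ≤ P.lagrangian x u :=
  csInf_le (isLeast_dual hP hut hu).bddBelow ⟨x, hx, rfl⟩

/-- The constraint values at `x̄(u)` form a supergradient of the dual function at `u`. -/
theorem dual_le_add_inner (hP : P.BasicAssumptions) {ut : DualVec m p}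
    (hut : P.ConstraintAssumptions ut) {u v : DualVec m p} (hu : u ∈ dualFeasibleExt ut)
    (hv : v ∈ dualFeasibleExt ut) :
    P.dual v ≤ P.dual u + ⟪P.constr (P.xBar u), v - u⟫_ℝ := by
  have h := dual_le hP hut hv (xBar_spec hP hut hu).1
  rw [dual_eq hP hut hu]
  rw [lagrangian_eq] at h ⊢
  rw [inner_sub_right, real_inner_comm v, real_inner_comm u]
  linarith

/-- Adding the quadratic growth inequalities at the two minimizers cancels `f`. This qualitative
constant serves only for differentiability and boundedness; the rates use `γ`. -/
theorem exists_lipschitz_xBar (hP : P.BasicAssumptions) {ut : DualVec m p}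
    (hut : P.ConstraintAssumptions ut) :
    ∃ C, 0 ≤ C ∧ ∀ u ∈ dualFeasibleExt ut, ∀ v ∈ dualFeasibleExt ut,
      ‖P.xBar u - P.xBar v‖ ≤ C * ‖u - v‖ := by
  obtain ⟨μ, hμ, h⟩ := hut.exists_strongConvexOn hP
  refine ⟨P.constrLip / μ, div_nonneg P.constrLip_nonneg hμ.le, fun u hu v hv => ?_⟩
  obtain ⟨hx, hxm⟩ := xBar_spec hP hut hu
  obtain ⟨hy, hym⟩ := xBar_spec hP hut hv
  have h1 := StrongConvexOn.quadratic_growth (h u hu) hx hxm hy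
  have h2 := StrongConvexOn.quadratic_growth (h v hv) hy hym hx
  simp only [lagrangian_eq] at h1 h2
  rw [norm_sub_rev (P.xBar v)] at h2
  have h3 : ⟪u - v, P.constr (P.xBar v) - P.constr (P.xBar u)⟫_ℝ
      ≤ ‖u - v‖ * (P.constrLip * ‖P.xBar u - P.xBar v‖) := by
    refine (real_inner_le_norm _ _).trans (mul_le_mul_of_nonneg_left ?_ (norm_nonneg _))
    rw [norm_sub_rev]
    exact hP.norm_constr_sub_le hx hy
  simp only [inner_sub_left, inner_sub_right] at h3
  have h4 := le_div_of_mul_sq_le (a := μ) (norm_nonneg (P.xBar u - P.xBar v))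
    (t := P.constrLip * ‖u - v‖) (by linarith)
    (mul_nonneg P.constrLip_nonneg (norm_nonneg _)) hμ
  rwa [div_mul_eq_mul_div]

/-- The supergradient inequalities at `u` and at `v` squeeze the linearization error, and Lipschitz
continuity of `x̄` makes the gap between them quadratic in `‖v - u‖`. -/
theorem hasFDerivWithinAt_dual (hP : P.BasicAssumptions) {ut : DualVec m p}
    (hut : P.ConstraintAssumptions ut) {u : DualVec m p} (hu : u ∈ dualFeasibleExt ut) :
    HasFDerivWithinAt P.dual (innerSL ℝ (P.constr (P.xBar u))) (dualFeasibleExt ut) u := by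
  obtain ⟨C, hC, hlip⟩ := exists_lipschitz_xBar hP hut
  set c := P.constr (P.xBar u) with hc
  have hb : ∀ v ∈ dualFeasibleExt ut,
      ‖P.dual v - P.dual u - ⟪c, v - u⟫_ℝ‖ ≤ P.constrLip * C * ‖‖v - u‖ ^ 2‖ := by
    intro v hv
    have h1 := dual_le_add_inner hP hut hu hv
    have h2 := dual_le_add_inner hP hut hv hu
    have h3 : |⟪P.constr (P.xBar v) - c, v - u⟫_ℝ| ≤ P.constrLip * C * ‖v - u‖ ^ 2 := by
      have e1 := hP.norm_constr_sub_le (xBar_spec hP hut hv).1 (xBar_spec hP hut hu).1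
      have e2 := mul_le_mul_of_nonneg_left (hlip v hv u hu) P.constrLip_nonneg
      refine (abs_real_inner_le_norm _ _).trans ?_
      refine (mul_le_mul_of_nonneg_right (e1.trans e2) (norm_nonneg _)).trans (le_of_eq ?_)
      ring
    have h4 := (abs_le.1 h3).1
    rw [inner_sub_left] at h4
    have h5 : ⟪P.constr (P.xBar v), u - v⟫_ℝ = -⟪P.constr (P.xBar v), v - u⟫_ℝ := by
      rw [← inner_neg_right, neg_sub]
    rw [Real.norm_of_nonneg (sq_nonneg ‖v - u‖), Real.norm_eq_abs, abs_le]
    have h6 : 0 ≤ P.constrLip * C * ‖v - u‖ ^ 2 := by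
      have := P.constrLip_nonneg
      positivity
    constructor <;> linarith
  have hO : (fun v => P.dual v - P.dual u - ⟪c, v - u⟫_ℝ) =O[𝓝[dualFeasibleExt ut] u]
      fun v => ‖v - u‖ ^ 2 :=
    Asymptotics.IsBigO.of_bound _ (eventually_of_mem self_mem_nhdsWithin hb)
  have h0 : HasFDerivWithinAt (fun v => P.dual v - P.dual u - ⟪c, v - u⟫_ℝ)
      (0 : DualVec m p →L[ℝ] ℝ) (dualFeasibleExt ut) u := hO.hasFDerivWithinAt hu one_lt_two
  have h1 : HasFDerivWithinAt (fun v => ⟪c, v - u⟫_ℝ) (innerSL ℝ c) (dualFeasibleExt ut) u := by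
    have := (innerSL ℝ c).hasFDerivWithinAt (s := dualFeasibleExt ut) (x := u)
    refine (this.sub_const (innerSL ℝ c u)).congr_of_eventuallyEq ?_ ?_
    · exact Eventually.of_forall fun v => by simp [inner_sub_right]
    · simp
  have h2 := (h0.add h1).add_const (P.dual u)
  rw [zero_add] at h2
  refine h2.congr_of_eventuallyEq (Eventually.of_forall fun v => ?_) ?_
  · simp
  · simp

theorem hasGradientAt_dual (hP : P.BasicAssumptions) {ut : DualVec m p}
    (hut : P.ConstraintAssumptions ut) {u : DualVec m p} (hu : u ∈ dualFeasible m p) :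
    HasGradientAt P.dual (P.constr (P.xBar u)) u := by
  rw [hasGradientAt_iff_hasFDerivAt]
  exact (hasFDerivWithinAt_dual hP hut (dualFeasible_subset_ext hut.ut_neg hu)).hasFDerivAt
    (dualFeasibleExt_mem_nhds hut.ut_neg hu)

theorem gradDual_eq (hP : P.BasicAssumptions) {ut : DualVec m p}
    (hut : P.ConstraintAssumptions ut) {u : DualVec m p} (hu : u ∈ dualFeasible m p) :
    P.gradDual u = P.constr (P.xBar u) := (hasGradientAt_dual hP hut hu).gradient

/-- The first-order optimality condition at `x̄(u)`, with the nonsmooth objective kept intact. -/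
theorem sq_le_of_isMinOn_lagrangian (hP : P.BasicAssumptions) {ut : DualVec m p}
    (hut : P.ConstraintAssumptions ut) {u : DualVec m p} {x y : Vec n} (hx : x ∈ P.X)
    (hmin : IsMinOn (fun x => P.lagrangian x u) P.X x) (hy : y ∈ P.X) :
    P.θ / 2 * ‖x - y‖ ^ 2 ≤ P.f y - P.f x + ∑ i, u (Sum.inl i) * ⟪gradient (P.g i) x, y - x⟫_ℝ +
      ∑ j, u (Sum.inr j) * (P.eqRes y - P.eqRes x) j := by
  -- Minimality is tested at `x + t • (y - x)` and divided by `t`. Strong convexity handles `f`, the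
  -- slopes of the `g i` converge to gradients, and no sign of `u` is used.
  have hlim : Tendsto (fun t : ℝ => P.f y - P.f x - (1 - t) * (P.θ / 2 * ‖x - y‖ ^ 2) +
      ∑ i, u (Sum.inl i) * (t⁻¹ * (P.g i (x + t • (y - x)) - P.g i x)) +
      ∑ j, u (Sum.inr j) * (P.eqRes y - P.eqRes x) j) (𝓝[>] 0)
      (𝓝 (P.f y - P.f x - (1 - 0) * (P.θ / 2 * ‖x - y‖ ^ 2) +
        ∑ i, u (Sum.inl i) * ⟪gradient (P.g i) x, y - x⟫_ℝ +
        ∑ j, u (Sum.inr j) * (P.eqRes y - P.eqRes x) j)) := by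
    refine Tendsto.add_const _ (Tendsto.add ?_ (tendsto_finsetSum _ fun i _ => ?_))
    · have : Continuous fun t : ℝ => P.f y - P.f x - (1 - t) * (P.θ / 2 * ‖x - y‖ ^ 2) := by
        fun_prop
      exact (this.tendsto 0).mono_left nhdsWithin_le_nhds
    · exact (tendsto_slope_gradient (hut.differentiable_g i x hx) (y - x)).const_mul _
  have h0 := ge_of_tendsto (b := 0) hlim
    (eventually_of_mem (Ioo_mem_nhdsGT one_pos) fun t ht => ?_)
  · linarith
  have h1 := StrongConvexOn.add_smul_sub_le hP.strongConvex hx hy ht.1.le ht.2.le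
  have h2 : P.lagrangian x u ≤ P.lagrangian (x + t • (y - x)) u :=
    hmin (hP.convex.add_smul_sub_mem hx hy ⟨ht.1.le, ht.2.le⟩)
  have h3 : ∑ i, u (Sum.inl i) * (t⁻¹ * (P.g i (x + t • (y - x)) - P.g i x))
      = t⁻¹ * (∑ i, u (Sum.inl i) * P.g i (x + t • (y - x)) - ∑ i, u (Sum.inl i) * P.g i x) := by
    rw [← Finset.sum_sub_distrib, Finset.mul_sum]
    exact Finset.sum_congr rfl fun i _ => by ring
  have h4 : ∑ j, u (Sum.inr j) * P.eqRes (x + t • (y - x)) j - ∑ j, u (Sum.inr j) * P.eqRes x j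
      = t * ∑ j, u (Sum.inr j) * (P.eqRes y - P.eqRes x) j := by
    rw [← Finset.sum_sub_distrib, Finset.mul_sum]
    refine Finset.sum_congr rfl fun j _ => ?_
    have : P.eqRes (x + t • (y - x)) j - P.eqRes x j = t * (P.eqRes y - P.eqRes x) j := by
      rw [← PiLp.sub_apply, eqRes_sub, eqRes_sub, add_sub_cancel_left, map_smul]
      rfl
    rw [← mul_sub, this]
    ring
  rw [h3]
  simp only [lagrangian] at h2
  have ht := ht.1
  refine le_of_mul_le_mul_left ?_ ht
  rw [mul_add, mul_add, ← mul_assoc t, mul_inv_cancel₀ ht.ne', ← h4]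
  linarith

/-- The factor `√(m+1)` is Cauchy–Schwarz over `m + 1` numbers: the `m` inequality multipliers and
the norm of the whole equality block, which counts once because `σ_max(A)` bounds `A` as an
operator. -/
theorem sum_mul_inner_add_le (P : Problem n m p) (w : DualVec m p) (x h : Vec n) :
    ∑ i, w (Sum.inl i) * ⟪gradient (P.g i) x, h⟫_ℝ +
      ∑ j, w (Sum.inr j) * (Matrix.toEuclideanLin P.A h) j ≤
      √((m : ℝ) + 1) * max (sigmaMax P.A) (⨆ i, ‖gradient (P.g i) x‖) * ‖w‖ * ‖h‖ := by
  set M := max (sigmaMax P.A) (⨆ i, ‖gradient (P.g i) x‖) with hM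
  have hM0 : 0 ≤ M := (sigmaMax_nonneg _).trans (le_max_left _ _)
  have hg : ∀ i, ‖gradient (P.g i) x‖ ≤ M := fun i =>
    (le_ciSup (f := fun i => ‖gradient (P.g i) x‖) (Set.finite_range _).bddAbove i).trans
      (le_max_right _ _)
  set we : Vec p := WithLp.toLp 2 fun j => w (Sum.inr j) with hwe
  have h1 : ∑ i, w (Sum.inl i) * ⟪gradient (P.g i) x, h⟫_ℝ
      ≤ (∑ i, |w (Sum.inl i)|) * (M * ‖h‖) := by
    rw [Finset.sum_mul]
    refine Finset.sum_le_sum fun i _ => (le_abs_self _).trans ?_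
    rw [abs_mul]
    refine mul_le_mul_of_nonneg_left ((abs_real_inner_le_norm _ _).trans ?_) (abs_nonneg _)
    exact mul_le_mul_of_nonneg_right (hg i) (norm_nonneg _)
  have h2 : ∑ j, w (Sum.inr j) * (Matrix.toEuclideanLin P.A h) j ≤ ‖we‖ * (M * ‖h‖) := by
    have e : ∑ j, w (Sum.inr j) * (Matrix.toEuclideanLin P.A h) j
        = ⟪we, Matrix.toEuclideanLin P.A h⟫_ℝ := by
      simp [PiLp.inner_apply, hwe, mul_comm]
    rw [e]
    refine (real_inner_le_norm _ _).trans (mul_le_mul_of_nonneg_left ?_ (norm_nonneg _))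
    exact (norm_toEuclideanLin_le _ _).trans
      (mul_le_mul_of_nonneg_right (le_max_left _ _) (norm_nonneg _))
  have h3 : ∑ i, |w (Sum.inl i)| + ‖we‖ ≤ √((m : ℝ) + 1) * ‖w‖ := by
    refine le_of_sq_le_sq ?_ (by positivity)
    rw [mul_pow, Real.sq_sqrt (by positivity), dual_norm_sq]
    have h4 := sq_sum_le_card_mul_sum_sq (s := (Finset.univ : Finset (Option (Fin m))))
      (f := fun o => o.elim ‖we‖ fun i => |w (Sum.inl i)|)
    have h5 : ‖we‖ ^ 2 = ∑ j, w (Sum.inr j) ^ 2 := by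
      simp [EuclideanSpace.norm_sq_eq, hwe]
    simp only [Fintype.sum_option, Option.elim, sq_abs, h5, Finset.card_univ, Fintype.card_option,
      Fintype.card_fin, Nat.cast_add, Nat.cast_one] at h4
    rw [add_comm (∑ i, |w (Sum.inl i)|), add_comm (∑ i, w (Sum.inl i) ^ 2)]
    exact h4
  calc _ ≤ (∑ i, |w (Sum.inl i)| + ‖we‖) * (M * ‖h‖) := by linarith
    _ ≤ √((m : ℝ) + 1) * ‖w‖ * (M * ‖h‖) := mul_le_mul_of_nonneg_right h3 (by positivity)
    _ = _ := by ring

/-- One-sided Lipschitz estimate for `x̄`: the constant only involves the point `u`, which may lie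
outside the dual feasible set. -/
theorem norm_xBar_sub_le (hP : P.BasicAssumptions) {ut : DualVec m p}
    (hut : P.ConstraintAssumptions ut) {u v : DualVec m p} (hu : u ∈ dualFeasibleExt ut)
    (hv : v ∈ dualFeasible m p) : ‖P.xBar u - P.xBar v‖ ≤ P.gamma u * ‖u - v‖ := by
  obtain ⟨hx, hxm⟩ := xBar_spec hP hut hu
  obtain ⟨hy, hym⟩ := xBar_spec hP hut (dualFeasible_subset_ext hut.ut_neg hv)
  set x := P.xBar u with hxdef
  set y := P.xBar v with hydef
  have h1 := sq_le_of_isMinOn_lagrangian hP hut hx hxm hy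
  have h2 := StrongConvexOn.quadratic_growth (hP.strongConvexOn_lagrangian_of_mem hv) hy hym hx
  rw [norm_sub_rev y x] at h2
  -- Since `v ≥ 0` on these coordinates, the `g i` may be linearized at `x = x̄(u)`. After addition
  -- to `h1`, only `u - v` multiplies the gradients, all taken at `x`.
  have h3 : ∑ i, v (Sum.inl i) * (P.g i x - P.g i y)
      ≤ ∑ i, v (Sum.inl i) * -⟪gradient (P.g i) x, y - x⟫_ℝ := by
    refine Finset.sum_le_sum fun i _ => mul_le_mul_of_nonneg_left ?_ (hv i)
    have := ConvexOn.inner_gradient_le (hP.convex_g i) hx hy (hut.differentiable_g i x hx)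
    linarith
  have h4 := P.sum_mul_inner_add_le (u - v) x (y - x)
  rw [← eqRes_sub] at h4
  simp only [lagrangian] at h2
  simp only [mul_sub, sub_mul, mul_neg, Finset.sum_sub_distrib, Finset.sum_neg_distrib,
    PiLp.sub_apply] at h1 h3 h4
  rw [norm_sub_rev y x] at h4
  have h5 := le_div_of_mul_sq_le (norm_nonneg (x - y)) (a := P.θ)
    (t := √((m : ℝ) + 1) * max (sigmaMax P.A) (⨆ i, ‖gradient (P.g i) x‖) * ‖u - v‖)
    (by linarith)
    (mul_nonneg (mul_nonneg (Real.sqrt_nonneg _) ((sigmaMax_nonneg _).trans (le_max_left _ _)))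
      (norm_nonneg _)) hP.theta_pos
  refine h5.trans (le_of_eq ?_)
  rw [gamma, ← hxdef]
  ring

end Problem

/-! ### Boundedness, local constants and quadratic models -/

theorem isBounded_image_of_norm_sub_le {E F : Type*} [SeminormedAddCommGroup E]
    [SeminormedAddCommGroup F] {f : E → F} {S : Set E} {C : ℝ} (hC : 0 ≤ C)
    (h : ∀ x ∈ S, ∀ y ∈ S, ‖f x - f y‖ ≤ C * ‖x - y‖) (hS : Bornology.IsBounded S) :
    Bornology.IsBounded (f '' S) := by
  obtain ⟨B, hB⟩ := Metric.isBounded_iff.1 hS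
  refine Metric.isBounded_iff.2 ⟨C * B, ?_⟩
  rintro _ ⟨x, hx, rfl⟩ _ ⟨y, hy, rfl⟩
  rw [dist_eq_norm]
  refine (h x hx y hy).trans (mul_le_mul_of_nonneg_left ?_ hC)
  rw [← dist_eq_norm]
  exact hB hx hy

namespace Problem

variable {n m p : ℕ} {P : Problem n m p}

theorem isBounded_image_xBar (hP : P.BasicAssumptions) {ut : DualVec m p}
    (hut : P.ConstraintAssumptions ut) {S : Set (DualVec m p)} (hS : S ⊆ dualFeasibleExt ut)
    (hb : Bornology.IsBounded S) : Bornology.IsBounded (P.xBar '' S) := by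
  obtain ⟨C, hC, hlip⟩ := exists_lipschitz_xBar hP hut
  exact isBounded_image_of_norm_sub_le hC (fun u hu v hv => hlip u (hS hu) v (hS hv)) hb

theorem exists_norm_gradDual_le (hP : P.BasicAssumptions) {ut : DualVec m p}
    (hut : P.ConstraintAssumptions ut) {S : Set (DualVec m p)} (hS : S ⊆ dualFeasible m p)
    (hb : Bornology.IsBounded S) : ∃ G, ∀ u ∈ S, ‖P.gradDual u‖ ≤ G := by
  have hS' := hS.trans (dualFeasible_subset_ext hut.ut_neg)
  have h1 := isBounded_image_of_norm_sub_le (f := P.constr) P.constrLip_nonneg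
    (S := P.xBar '' S) (by
      rintro _ ⟨u, hu, rfl⟩ _ ⟨v, hv, rfl⟩
      exact hP.norm_constr_sub_le (xBar_spec hP hut (hS' hu)).1 (xBar_spec hP hut (hS' hv)).1)
    (isBounded_image_xBar hP hut hS' hb)
  obtain ⟨G, hG⟩ := isBounded_iff_forall_norm_le.1 h1
  refine ⟨G, fun u hu => ?_⟩
  rw [gradDual_eq hP hut (hS hu)]
  exact hG _ ⟨_, ⟨u, hu, rfl⟩, rfl⟩

theorem bddAbove_gamma (hP : P.BasicAssumptions) {ut : DualVec m p}
    (hut : P.ConstraintAssumptions ut) {S : Set (DualVec m p)} (hS : S ⊆ dualFeasibleExt ut)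
    (hb : Bornology.IsBounded S) : BddAbove (P.gamma '' S) := by
  have h1 := isBounded_image_xBar hP hut hS hb
  have hX : P.xBar '' S ⊆ P.X := by
    rintro _ ⟨u, hu, rfl⟩
    exact (xBar_spec hP hut (hS hu)).1
  have h2 := fun i => isBounded_iff_forall_norm_le.1 (hut.bounded_gradient i _ hX h1)
  choose M hM using h2
  refine ⟨√((m : ℝ) + 1) / P.θ * max (sigmaMax P.A) (∑ i, |M i|), ?_⟩
  rintro _ ⟨u, hu, rfl⟩
  refine mul_le_mul_of_nonneg_left (max_le_max le_rfl ?_)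
    (div_nonneg (Real.sqrt_nonneg _) hP.theta_pos.le)
  refine Real.iSup_le (fun i => ?_) (Finset.sum_nonneg fun i _ => abs_nonneg _)
  refine ((hM i _ ⟨_, ⟨u, hu, rfl⟩, rfl⟩).trans (le_abs_self _)).trans ?_
  exact Finset.single_le_sum (f := fun i => |M i|) (fun i _ => abs_nonneg _) (Finset.mem_univ i)

theorem gamma_mul_constrLip_le {S : Set (DualVec m p)} (hb : BddAbove (P.gamma '' S))
    {u : DualVec m p} (hu : u ∈ S) : P.gamma u * P.constrLip ≤ P.lipConst S :=
  mul_le_mul_of_nonneg_right (le_csSup hb ⟨u, hu, rfl⟩) P.constrLip_nonneg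

theorem lipConst_nonneg (hθ : 0 < P.θ) (S : Set (DualVec m p)) : 0 ≤ P.lipConst S := by
  refine mul_nonneg (Real.sSup_nonneg ?_) P.constrLip_nonneg
  rintro _ ⟨u, -, rfl⟩
  exact mul_nonneg (div_nonneg (Real.sqrt_nonneg _) hθ.le)
    ((sigmaMax_nonneg _).trans (le_max_left _ _))

theorem norm_constr_xBar_sub_le (hP : P.BasicAssumptions) {ut : DualVec m p}
    (hut : P.ConstraintAssumptions ut) {u v : DualVec m p} (hu : u ∈ dualFeasibleExt ut)
    (hv : v ∈ dualFeasible m p) :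
    ‖P.constr (P.xBar u) - P.constr (P.xBar v)‖ ≤ P.gamma u * P.constrLip * ‖u - v‖ := by
  refine (hP.norm_constr_sub_le (xBar_spec hP hut hu).1
    (xBar_spec hP hut (dualFeasible_subset_ext hut.ut_neg hv)).1).trans ?_
  refine (mul_le_mul_of_nonneg_left (norm_xBar_sub_le hP hut hu hv) P.constrLip_nonneg).trans
    (le_of_eq ?_)
  ring

/-- A lower quadratic model of the dual function along a segment. -/
theorem dual_ge_of_segment (hP : P.BasicAssumptions) {ut : DualVec m p}
    (hut : P.ConstraintAssumptions ut) {u w : DualVec m p} (hu : u ∈ dualFeasibleExt ut)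
    (hw : w ∈ dualFeasibleExt ut) {L : ℝ}
    (hL : ∀ t ∈ Set.Icc (0 : ℝ) 1,
      ‖P.constr (P.xBar (u + t • (w - u))) - P.constr (P.xBar u)‖ ≤ L * (t * ‖w - u‖)) :
    P.dual u + ⟪P.constr (P.xBar u), w - u⟫_ℝ - L / 2 * ‖w - u‖ ^ 2 ≤ P.dual w := by
  set a := P.constr (P.xBar u)
  set h := w - u
  have hmaps : Set.MapsTo (fun t : ℝ => u + t • h) (Set.Icc 0 1) (dualFeasibleExt ut) :=
    fun t ht => (convex_dualFeasibleExt ut).add_smul_sub_mem hu hw ht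
  -- The bound `hL` makes the derivative of this auxiliary function nonnegative; comparing its
  -- values at `0` and `1` is the claim.
  have hder : ∀ t ∈ Set.Icc (0 : ℝ) 1, HasDerivWithinAt
      (fun t : ℝ => P.dual (u + t • h) - t * ⟪a, h⟫_ℝ + t ^ 2 * (L / 2 * ‖h‖ ^ 2))
      (⟪P.constr (P.xBar (u + t • h)), h⟫_ℝ - ⟪a, h⟫_ℝ + 2 * t * (L / 2 * ‖h‖ ^ 2))
      (Set.Icc 0 1) t := by
    intro t ht
    have h1 : HasDerivWithinAt (fun t : ℝ => u + t • h) h (Set.Icc 0 1) t := by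
      simpa using ((hasDerivAt_id t).smul_const h).const_add u |>.hasDerivWithinAt
    have h2 := (hasFDerivWithinAt_dual hP hut (hmaps ht)).comp_hasDerivWithinAt t h1 hmaps
    have h3 : HasDerivWithinAt (fun t : ℝ => t * ⟪a, h⟫_ℝ) ⟪a, h⟫_ℝ (Set.Icc 0 1) t := by
      simpa using ((hasDerivAt_id t).mul_const ⟪a, h⟫_ℝ).hasDerivWithinAt
    have h4 : HasDerivWithinAt (fun t : ℝ => t ^ 2 * (L / 2 * ‖h‖ ^ 2))
        (2 * t * (L / 2 * ‖h‖ ^ 2)) (Set.Icc 0 1) t := by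
      simpa using ((hasDerivAt_pow 2 t).mul_const (L / 2 * ‖h‖ ^ 2)).hasDerivWithinAt
    exact (h2.sub h3).add h4
  have hmono := monotoneOn_of_hasDerivWithinAt_nonneg (convex_Icc (0 : ℝ) 1)
    (fun t ht => (hder t ht).continuousWithinAt)
    (fun t ht => (hder t (interior_subset ht)).mono interior_subset) (fun t ht => ?_)
  · have := hmono (Set.left_mem_Icc.2 zero_le_one) (Set.right_mem_Icc.2 zero_le_one) zero_le_one
    simp only [zero_smul, add_zero, zero_mul, sub_zero, one_smul, one_mul, one_pow, ne_eq,
      OfNat.ofNat_ne_zero, not_false_eq_true, zero_pow] at this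
    rw [show u + h = w from add_sub_cancel u w] at this
    linarith
  · have ht' := interior_subset ht
    have h1 := hL t ht'
    have h2 := (abs_le.1 (abs_real_inner_le_norm
      (P.constr (P.xBar (u + t • h)) - a) h)).1
    have h3 := mul_le_mul_of_nonneg_right h1 (norm_nonneg h)
    rw [inner_sub_left] at h2
    linarith

theorem dual_ge_of_mem (hP : P.BasicAssumptions) {ut : DualVec m p}
    (hut : P.ConstraintAssumptions ut) {u w : DualVec m p} (hu : u ∈ dualFeasible m p)
    (hw : w ∈ dualFeasible m p) {L : ℝ} (hL : P.gamma u * P.constrLip ≤ L) :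
    P.dual u + ⟪P.constr (P.xBar u), w - u⟫_ℝ - L / 2 * ‖w - u‖ ^ 2 ≤ P.dual w := by
  have hsub := dualFeasible_subset_ext hut.ut_neg
  refine dual_ge_of_segment hP hut (hsub hu) (hsub hw) fun t ht => ?_
  have h1 := norm_constr_xBar_sub_le hP hut (hsub hu)
    (convex_dualFeasible.add_smul_sub_mem hu hw ht)
  rw [norm_sub_rev, sub_add_cancel_left, norm_neg, norm_smul, Real.norm_of_nonneg ht.1] at h1
  exact h1.trans (mul_le_mul_of_nonneg_right hL (mul_nonneg ht.1 (norm_nonneg _)))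

/-- The value of `d` at `u + β • (a - b)` is bounded below by the quadratic model at `u` and above
by the supergradient at `v`. The segment stays in the convex set `T`, where `L` dominates the local
constants. -/
theorem dual_add_sq_le (hP : P.BasicAssumptions) {ut : DualVec m p}
    (hut : P.ConstraintAssumptions ut) {u v a b : DualVec m p} (hu : u ∈ dualFeasible m p)
    (hv : v ∈ dualFeasible m p) (ha : a = P.constr (P.xBar u)) (hb : b = P.constr (P.xBar v))
    {β L : ℝ} {T : Set (DualVec m p)} (hT : T ⊆ dualFeasibleExt ut) (hTc : Convex ℝ T)
    (huT : u ∈ T) (hw : u + β • (a - b) ∈ T) (hL : ∀ w ∈ T, P.gamma w * P.constrLip ≤ L) :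
    P.dual u + ⟪b, v - u⟫_ℝ + (β - L / 2 * β ^ 2) * ‖a - b‖ ^ 2 ≤ P.dual v := by
  have hsub := dualFeasible_subset_ext hut.ut_neg
  have h1 := dual_ge_of_segment hP hut (hsub hu) (hT hw) (L := L) fun t ht => by
    have hz := hTc.add_smul_sub_mem huT hw ht
    have := norm_constr_xBar_sub_le hP hut (hT hz) hu
    rw [add_sub_cancel_left u (t • _), norm_smul, Real.norm_of_nonneg ht.1] at this
    exact this.trans (mul_le_mul_of_nonneg_right (hL _ hz) (mul_nonneg ht.1 (norm_nonneg _)))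
  have h2 := dual_le_add_inner hP hut (hsub hv) (hT hw)
  rw [← ha, add_sub_cancel_left, inner_smul_right, norm_smul, mul_pow, Real.norm_eq_abs,
    sq_abs] at h1
  rw [← hb, show u + β • (a - b) - v = β • (a - b) - (v - u) by abel, inner_sub_right,
    inner_smul_right] at h2
  have h3 : ⟪a, a - b⟫_ℝ - ⟪b, a - b⟫_ℝ = ‖a - b‖ ^ 2 := by
    rw [← inner_sub_left, real_inner_self_eq_norm_sq]
  linear_combination h1 + h2 - β * h3

/-! ### The sets `Φ(S)`, `Ψ(S)` and cocoercivity of the dual gradient -/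

section Sets

variable {ut : DualVec m p} {S : Set (DualVec m p)}

theorem bddAbove_etaQuotients (hP : P.BasicAssumptions) (hut : P.ConstraintAssumptions ut)
    (hS : S ⊆ dualFeasible m p) (hb : Bornology.IsBounded S) :
    BddAbove (P.etaQuotients ut S) := by
  obtain ⟨G, hG⟩ := exists_norm_gradDual_le hP hut hS hb
  refine ⟨∑ i : Fin m, 2 * G / -ut (Sum.inl i), ?_⟩
  rintro _ ⟨u, hu, v, hv, i, rfl⟩
  have hG0 : 0 ≤ G := (norm_nonneg _).trans (hG u hu)
  have hneg : ∀ i : Fin m, 0 < -ut (Sum.inl i) := fun i => neg_pos.2 (hut.ut_neg i)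
  have h1 : |P.gradDual u (Sum.inl i) - P.gradDual v (Sum.inl i)| ≤ 2 * G := by
    have h2 := PiLp.norm_apply_le (P.gradDual u) (Sum.inl i)
    have h3 := PiLp.norm_apply_le (P.gradDual v) (Sum.inl i)
    rw [Real.norm_eq_abs] at h2 h3
    have := abs_sub (P.gradDual u (Sum.inl i)) (P.gradDual v (Sum.inl i))
    linarith [hG u hu, hG v hv]
  rw [neg_div, ← div_neg]
  refine (div_le_div_of_nonneg_right h1 (hneg i).le).trans ?_
  exact Finset.single_le_sum (f := fun i : Fin m => 2 * G / -ut (Sum.inl i))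
    (fun i _ => div_nonneg (by linarith) (hneg i).le) (Finset.mem_univ i)

theorem eta_nonneg (hθ : 0 < P.θ) : 0 ≤ P.eta ut S := by
  unfold eta
  split_ifs with h
  · exact h.le
  · exact div_nonneg (sq_nonneg _) hθ.le

theorem abs_sub_le_sSup_mul (hut : P.ConstraintAssumptions ut)
    (hb : BddAbove (P.etaQuotients ut S)) {u v : DualVec m p} (hu : u ∈ S) (hv : v ∈ S)
    (i : Fin m) : |P.gradDual u (Sum.inl i) - P.gradDual v (Sum.inl i)|
      ≤ sSup (P.etaQuotients ut S) * -ut (Sum.inl i) := by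
  have h := le_csSup hb ⟨u, hu, v, hv, i, rfl⟩
  rwa [neg_div, ← div_neg, div_le_iff₀ (neg_pos.2 (hut.ut_neg i))] at h

/-- The definition of `η(S)` is designed for this: with `β ≤ 1/η(S)`, the `i`-th coordinate starts
nonnegative and moves by at most `-ut i`. In the fallback case the inequality components of the
gradient do not vary on `S`. -/
theorem add_smul_sub_gradDual_mem (hut : P.ConstraintAssumptions ut)
    (hS : S ⊆ dualFeasible m p) (hb : BddAbove (P.etaQuotients ut S)) {u v : DualVec m p}
    (hu : u ∈ S) (hv : v ∈ S) {β : ℝ} (hβ : β ∈ Set.Icc 0 (1 / P.eta ut S)) :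
    u + β • (P.gradDual u - P.gradDual v) ∈ dualFeasibleExt ut := by
  intro i
  have h1 := abs_sub_le_sSup_mul hut hb hu hv i
  have h2 := hS hu i
  have hneg := neg_pos.2 (hut.ut_neg i)
  simp only [PiLp.add_apply, PiLp.smul_apply, PiLp.sub_apply, smul_eq_mul]
  set δ := P.gradDual u (Sum.inl i) - P.gradDual v (Sum.inl i)
  suffices β * |δ| ≤ -ut (Sum.inl i) by
    have h3 := mul_le_mul_of_nonneg_left (neg_abs_le δ) hβ.1
    linarith
  have hβ2 := hβ.2
  unfold eta at hβ2
  split_ifs at hβ2 with h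
  · rw [le_div_iff₀ h] at hβ2
    have h3 := mul_le_mul_of_nonneg_left h1 hβ.1
    have h4 := mul_le_mul_of_nonneg_right hβ2 hneg.le
    linarith
  · have : |δ| ≤ 0 := h1.trans (mul_nonpos_of_nonpos_of_nonneg (not_lt.1 h) hneg.le)
    have h3 := mul_nonpos_of_nonneg_of_nonpos hβ.1 this
    linarith

theorem Psi_subset (hut : P.ConstraintAssumptions ut) (hS : S ⊆ dualFeasible m p)
    (hb : BddAbove (P.etaQuotients ut S)) : P.Psi ut S ⊆ dualFeasibleExt ut := by
  unfold Psi
  split_ifs with h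
  · refine convexHull_min ?_ (convex_dualFeasibleExt ut)
    rintro _ ⟨u, hu, v, hv, β, hβ, rfl⟩
    exact add_smul_sub_gradDual_mem hut hS hb hu hv hβ
  · exact hS.trans (dualFeasible_subset_ext hut.ut_neg)

theorem subset_Psi : S ⊆ P.Psi ut S := by
  intro u hu
  unfold Psi
  split_ifs with h
  · exact subset_convexHull ℝ _ ⟨u, hu, u, hu, 0, ⟨le_rfl, by positivity⟩, by simp⟩
  · exact hu

theorem isBounded_Psi (hP : P.BasicAssumptions) (hut : P.ConstraintAssumptions ut)
    (hS : S ⊆ dualFeasible m p) (hb : Bornology.IsBounded S) :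
    Bornology.IsBounded (P.Psi ut S) := by
  obtain ⟨G, hG⟩ := exists_norm_gradDual_le hP hut hS hb
  obtain ⟨B, hB⟩ := isBounded_iff_forall_norm_le.1 hb
  unfold Psi
  split_ifs with h
  · rw [isBounded_convexHull, isBounded_iff_forall_norm_le]
    refine ⟨B + 1 / P.eta ut S * (G + G), ?_⟩
    rintro _ ⟨u, hu, v, hv, β, hβ, rfl⟩
    refine (norm_add_le _ _).trans (add_le_add (hB u hu) ?_)
    rw [norm_smul, Real.norm_of_nonneg hβ.1]
    exact mul_le_mul hβ.2 ((norm_sub_le _ _).trans (add_le_add (hG u hu) (hG v hv)))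
      (norm_nonneg _) (hβ.1.trans hβ.2)
  · exact hb

theorem Phi_subset : P.Phi S ⊆ dualFeasible m p := by
  refine convexHull_min ?_ convex_dualFeasible
  rintro _ ⟨u, -, β, -, rfl⟩
  rw [proj_eq_clip]
  exact clip_mem _

theorem subset_Phi (hθ : 0 < P.θ) (hS : S ⊆ dualFeasible m p) : S ⊆ P.Phi S := by
  intro u hu
  refine subset_convexHull ℝ _ ⟨u, hu, 0,
    ⟨le_rfl, one_div_nonneg.2 (lipConst_nonneg hθ S)⟩, ?_⟩
  rw [proj_eq_clip, zero_smul, add_zero, clip_of_mem (hS hu)]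

theorem isBounded_Phi (hP : P.BasicAssumptions) (hut : P.ConstraintAssumptions ut)
    (hS : S ⊆ dualFeasible m p) (hb : Bornology.IsBounded S) :
    Bornology.IsBounded (P.Phi S) := by
  obtain ⟨G, hG⟩ := exists_norm_gradDual_le hP hut hS hb
  obtain ⟨B, hB⟩ := isBounded_iff_forall_norm_le.1 hb
  rw [Phi, isBounded_convexHull, isBounded_iff_forall_norm_le]
  refine ⟨B + 1 / P.lipConst S * G, ?_⟩
  rintro _ ⟨u, hu, β, hβ, rfl⟩
  rw [proj_eq_clip]
  have h0 : clip (0 : DualVec m p) = 0 := clip_of_mem fun i => le_rfl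
  have h1 := norm_clip_sub_clip_le (u + β • P.gradDual u) 0
  rw [h0, sub_zero, sub_zero] at h1
  refine h1.trans ((norm_add_le _ _).trans (add_le_add (hB u hu) ?_))
  rw [norm_smul, Real.norm_of_nonneg hβ.1]
  exact mul_le_mul hβ.2 (hG u hu) (norm_nonneg _) (hβ.1.trans hβ.2)

theorem lipConst_pos (hP : P.BasicAssumptions) (hb : BddAbove (P.gamma '' S)) {u : DualVec m p}
    (hu : u ∈ S) (hγ : 0 < P.gamma u) : 0 < P.lipConst S :=
  (mul_pos hγ hP.constrLip_pos).trans_le (gamma_mul_constrLip_le hb hu)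

/-- If `η(S) = 0`, the dual gradient is constant on `S`. -/
theorem gradDual_eq_of_eta_eq_zero (hP : P.BasicAssumptions) (hut : P.ConstraintAssumptions ut)
    (hb : BddAbove (P.etaQuotients ut S)) (hη : P.eta ut S = 0) {u v : DualVec m p} (hu : u ∈ S)
    (hv : v ∈ S) : P.gradDual u = P.gradDual v := by
  unfold eta at hη
  split_ifs at hη with h
  · exact absurd hη h.ne'
  have hσ : sigmaMax P.A = 0 := by
    rcases div_eq_zero_iff.1 hη with h0 | h0
    · exact pow_eq_zero_iff two_ne_zero |>.1 h0
    · exact absurd h0 hP.theta_pos.ne'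
  have hp : p = 0 := by
    by_contra hp
    exact (sigmaMax_pos (hP.A_ne_zero hp)).ne' hσ
  subst hp
  ext (i | j)
  · have h1 := abs_sub_le_sSup_mul hut hb hu hv i
    have h2 := mul_nonpos_of_nonpos_of_nonneg (not_lt.1 h) (neg_pos.2 (hut.ut_neg i)).le
    exact sub_eq_zero.1 (abs_nonpos_iff.1 (h1.trans h2))
  · exact j.elim0

/-- This replaces the Baillon–Haddad inequality, whose usual proof needs a Lipschitz gradient on a
set containing the auxiliary points `u + β • (∇d(u) - ∇d(v))`; here these lie in `Ψ(S)`. -/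
theorem gradDual_cocoercive (hP : P.BasicAssumptions) (hut : P.ConstraintAssumptions ut)
    (hS : S ⊆ dualFeasible m p) (hb : Bornology.IsBounded S) (hL : 0 < P.lipConst (P.Psi ut S))
    {u v : DualVec m p} (hu : u ∈ S) (hv : v ∈ S) {α : ℝ} (hα : α ≤ P.stepBound ut S) :
    α * ‖P.gradDual u - P.gradDual v‖ ^ 2 ≤ 2 * ⟪P.gradDual u - P.gradDual v, v - u⟫_ℝ := by
  have hbq := bddAbove_etaQuotients hP hut hS hb
  have hΨ := Psi_subset hut hS hbq
  have hbγ := bddAbove_gamma hP hut hΨ (isBounded_Psi hP hut hS hb)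
  rcases (eta_nonneg (S := S) (ut := ut) hP.theta_pos).eq_or_lt with hη | hη
  · rw [gradDual_eq_of_eta_eq_zero hP hut hbq hη.symm hu hv]
    simp
  set L := P.lipConst (P.Psi ut S) with hLdef
  have hconv : Convex ℝ (P.Psi ut S) := by
    rw [Psi, if_pos hη]
    exact convex_convexHull ℝ _
  have key : ∀ β ∈ Set.Icc 0 (1 / P.eta ut S), α ≤ 4 * (β - L / 2 * β ^ 2) →
      α * ‖P.gradDual u - P.gradDual v‖ ^ 2 ≤ 2 * ⟪P.gradDual u - P.gradDual v, v - u⟫_ℝ := by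
    intro β hβ hαβ
    have hmem : ∀ u ∈ S, ∀ v ∈ S, u + β • (P.gradDual u - P.gradDual v) ∈ P.Psi ut S := by
      intro u hu v hv
      rw [Psi, if_pos hη]
      exact subset_convexHull ℝ _ ⟨u, hu, v, hv, β, hβ, rfl⟩
    have hγ : ∀ w ∈ P.Psi ut S, P.gamma w * P.constrLip ≤ L := fun w hw =>
      gamma_mul_constrLip_le hbγ hw
    have h1 := dual_add_sq_le hP hut (hS hu) (hS hv) (gradDual_eq hP hut (hS hu))
      (gradDual_eq hP hut (hS hv)) hΨ hconv (subset_Psi hu) (hmem u hu v hv) hγ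
    -- Exchanging `u` and `v` and adding cancels the dual values, which doubles the coefficient `β -
    -- L/2 * β²`.
    have h2 := dual_add_sq_le hP hut (hS hv) (hS hu) (gradDual_eq hP hut (hS hv))
      (gradDual_eq hP hut (hS hu)) hΨ hconv (subset_Psi hv) (hmem v hv u hu) hγ
    rw [norm_sub_rev, ← neg_sub v u, inner_neg_right] at h2
    have h3 := mul_le_mul_of_nonneg_right hαβ (sq_nonneg ‖P.gradDual u - P.gradDual v‖)
    rw [inner_sub_left]
    linarith
  unfold stepBound at hα
  rw [← hLdef] at hα
  -- The coefficient is largest at `β = 1/L`, which is allowed when `L > η`; otherwise the endpoint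
  -- `1/η` is taken.
  split_ifs at hα with h
  · refine key (1 / L) ⟨by positivity, one_div_le_one_div_of_le hη h.le⟩ (hα.trans (le_of_eq ?_))
    field_simp
    ring
  · refine key (1 / P.eta ut S) ⟨by positivity, le_rfl⟩ (hα.trans (le_of_eq ?_))
    field_simp

/-- Both branches are values of `4 (β - L/2 * β²)`, whose maximum over `β` is `2/L`. This makes `δ`
positive. -/
theorem stepBound_le (hL : 0 < P.lipConst (P.Psi ut S)) :
    P.stepBound ut S ≤ 2 / P.lipConst (P.Psi ut S) := by
  unfold stepBound
  split_ifs with h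
  · exact le_rfl
  · set L := P.lipConst (P.Psi ut S)
    set η := P.eta ut S
    have hη : 0 < η := hL.trans_le (not_lt.1 h)
    rw [le_div_iff₀ hL]
    have : 4 * (1 / η - L / (2 * η ^ 2)) * L = 2 - 2 * (1 - L / η) ^ 2 := by
      field_simp
      ring
    rw [this]
    linarith [sq_nonneg (1 - L / η)]

end Sets

end Problem

/-- The rate `O(1/k)` for nonnegative sequences with a quadratic decrease. -/
theorem le_div_of_quadratic_decrease {e : ℕ → ℝ} {c : ℝ} (hc : 0 ≤ c) (h0 : ∀ k, 0 ≤ e k)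
    (h : ∀ k, e (k + 1) ≤ e k - c * e k ^ 2) (k : ℕ) : e k ≤ e 0 / (1 + k * e 0 * c) := by
  have hpos : ∀ k : ℕ, 0 < 1 + k * e 0 * c := fun k => by
    have := h0 0
    positivity
  suffices e k * (1 + k * e 0 * c) ≤ e 0 from (le_div_iff₀ (hpos k)).2 this
  induction k with
  | zero => simp
  | succ k ih =>
    set a := e k
    set E := e 0
    have ha : 0 ≤ a := h0 k
    have hE : 0 ≤ E := h0 0
    -- This is the division-free form of the fact that `1/e` grows by at least `c` per step: `(a - c
    -- a²)(1 + c a) = a - c² a³`.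
    have h1 : e (k + 1) * (1 + c * a) ≤ a := by
      have h2 := mul_le_mul_of_nonneg_right (h k) (by positivity : 0 ≤ 1 + c * a)
      have h3 : 0 ≤ c ^ 2 * a ^ 3 := by positivity
      linarith
    have h2 : a * (1 + (k + 1) * E * c) ≤ E * (1 + c * a) := by
      linarith
    have h3 := mul_le_mul_of_nonneg_right h1 (by positivity : 0 ≤ 1 + (k + 1) * E * c)
    push_cast
    refine le_of_mul_le_mul_right ?_ (by positivity : 0 < 1 + c * a)
    linarith

/-- Estimates for one coordinate of a projected gradient step. -/
theorem clip_step_estimates {u a L : ℝ} (hL : 0 < L) (hu : 0 ≤ u) {h : ℝ}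
    (hh : h = max 0 (u + L⁻¹ * a) - u) :
    L / 2 * h ^ 2 ≤ a * h - L / 2 * h ^ 2 ∧
      max 0 a ^ 2 ≤ 2 * L * (a * h - L / 2 * h ^ 2) ∧
      -(u * a) ≤ a * h - L / 2 * h ^ 2 - L * (u * h) := by
  obtain ⟨b, rfl⟩ : ∃ b, a = L * b := ⟨L⁻¹ * a, by rw [mul_inv_cancel_left₀ hL.ne']⟩
  rw [inv_mul_cancel_left₀ hL.ne'] at hh
  -- Either clipping is inactive and `h = b`, or it is active and `h = -u` with `b ≤ -u ≤ 0`.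
  rcases le_total 0 (u + b) with hb | hb
  · rw [max_eq_right hb, add_sub_cancel_left] at hh
    subst hh
    have h1 : 0 ≤ L * h ^ 2 := by positivity
    refine ⟨by linarith, ?_, by linarith⟩
    have h2 : max 0 (L * h) ^ 2 ≤ (L * h) ^ 2 := by
      rw [sq_le_sq, abs_of_nonneg (le_max_left _ _)]
      exact max_le (abs_nonneg _) (le_abs_self _)
    linarith
  · rw [max_eq_left hb, zero_sub] at hh
    subst hh
    have hb0 : b ≤ 0 := by linarith
    have h1 : 0 ≤ L * u * -(u + b) := mul_nonneg (by positivity) (by linarith)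
    have h2 : 0 ≤ L * u ^ 2 := by positivity
    refine ⟨by linarith, ?_, by linarith⟩
    rw [max_eq_left (mul_nonpos_of_nonneg_of_nonpos hL.le hb0)]
    have h3 := mul_nonneg hL.le h1
    have h4 := mul_nonneg hL.le h2
    linarith

/-! ### Dual optimality, primal estimates and the projected step -/

namespace Problem

variable {n m p : ℕ} {P : Problem n m p} {ut us u : DualVec m p}

theorem dStar_eq (hus : us ∈ P.dualOptimal) : P.dStar = P.dual us := by
  refine IsGreatest.csSup_eq ⟨⟨us, hus.1, rfl⟩, ?_⟩
  rintro _ ⟨v, hv, rfl⟩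
  exact hus.2 hv

theorem inner_constr_le_of_dualOptimal (hP : P.BasicAssumptions) (hut : P.ConstraintAssumptions ut)
    (hus : us ∈ P.dualOptimal) {v : DualVec m p} (hv : v ∈ dualFeasible m p) :
    ⟪P.constr (P.xBar us), v - us⟫_ℝ ≤ 0 := by
  have hg := hasGradientAt_dual hP hut hus.1
  rw [← hg.gradient]
  refine le_of_tendsto (tendsto_slope_gradient hg.differentiableAt (v - us))
    (eventually_of_mem (Ioo_mem_nhdsGT one_pos) fun t ht => ?_)
  have h1 : P.dual (us + t • (v - us)) ≤ P.dual us :=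
    hus.2 (convex_dualFeasible.add_smul_sub_mem hus.1 hv ⟨ht.1.le, ht.2.le⟩)
  exact mul_nonpos_of_nonneg_of_nonpos (inv_nonneg.2 ht.1.le) (sub_nonpos.2 h1)

theorem constr_inl_nonpos_of_dualOptimal (hP : P.BasicAssumptions)
    (hut : P.ConstraintAssumptions ut) (hus : us ∈ P.dualOptimal) (i : Fin m) :
    P.g i (P.xBar us) ≤ 0 := by
  have h := inner_constr_le_of_dualOptimal hP hut hus
    (v := us + EuclideanSpace.single (Sum.inl i) 1) fun i' => ?_
  · rw [add_sub_cancel_left, EuclideanSpace.inner_single_right] at h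
    simpa using h
  · have := hus.1 i'
    by_cases hi : i' = i
    · subst hi
      simp
      linarith
    · simpa [hi] using this

theorem eqRes_eq_zero_of_dualOptimal (hP : P.BasicAssumptions)
    (hut : P.ConstraintAssumptions ut) (hus : us ∈ P.dualOptimal) :
    P.eqRes (P.xBar us) = 0 := by
  ext j
  have h : ∀ s : ℝ, s * P.eqRes (P.xBar us) j ≤ 0 := fun s => by
    have h := inner_constr_le_of_dualOptimal hP hut hus
      (v := us + EuclideanSpace.single (Sum.inr j) s) fun i => by simpa using hus.1 i
    rw [add_sub_cancel_left, EuclideanSpace.inner_single_right] at h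
    simpa using h
  have h1 := h 1
  have h2 := h (-1)
  simp only [PiLp.zero_apply]
  linarith

theorem inner_constr_eq_zero_of_dualOptimal (hP : P.BasicAssumptions)
    (hut : P.ConstraintAssumptions ut) (hus : us ∈ P.dualOptimal) :
    ⟪us, P.constr (P.xBar us)⟫_ℝ = 0 := by
  refine le_antisymm ?_ ?_
  · rw [dual_inner_eq]
    simp only [constr_inl, constr_inr, eqRes_eq_zero_of_dualOptimal hP hut hus, PiLp.zero_apply,
      mul_zero, Finset.sum_const_zero, add_zero]
    exact Finset.sum_nonpos fun i _ => mul_nonpos_of_nonneg_of_nonpos (hus.1 i)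
      (constr_inl_nonpos_of_dualOptimal hP hut hus i)
  · have h := inner_constr_le_of_dualOptimal hP hut hus (v := 0) fun i => le_rfl
    rw [zero_sub, inner_neg_right, real_inner_comm] at h
    linarith

theorem inner_constr_nonpos_of_feasible {x : Vec n} (hx : x ∈ P.feasible)
    (hu : u ∈ dualFeasible m p) : ⟪u, P.constr x⟫_ℝ ≤ 0 := by
  rw [dual_inner_eq]
  simp only [constr_inl, constr_inr, hx.2.2, PiLp.zero_apply, mul_zero, Finset.sum_const_zero,
    add_zero]
  exact Finset.sum_nonpos fun i _ => mul_nonpos_of_nonneg_of_nonpos (hu i) (hx.2.1 i)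

/-- The variational inequality at `us`, tested with coordinate directions and with `0`, gives
feasibility of `x̄(us)` and complementary slackness; weak duality then makes this point optimal. -/
theorem strong_duality (hP : P.BasicAssumptions) (hut : P.ConstraintAssumptions ut)
    (hus : us ∈ P.dualOptimal) :
    P.fStar = P.dStar ∧ P.xStar ∈ P.feasible ∧ P.f P.xStar = P.fStar := by
  have hus' := dualFeasible_subset_ext hut.ut_neg hus.1
  have hfeas : P.xBar us ∈ P.feasible := ⟨(xBar_spec hP hut hus').1,
    constr_inl_nonpos_of_dualOptimal hP hut hus, eqRes_eq_zero_of_dualOptimal hP hut hus⟩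
  have hval : P.f (P.xBar us) = P.dual us := by
    rw [dual_eq hP hut hus', lagrangian_eq, inner_constr_eq_zero_of_dualOptimal hP hut hus,
      add_zero]
  have hmin : IsMinOn P.f P.feasible (P.xBar us) := by
    intro x hx
    have h1 := dual_le hP hut hus' hx.1
    have h2 := inner_constr_nonpos_of_feasible hx hus.1
    rw [lagrangian_eq] at h1
    change P.f (P.xBar us) ≤ P.f x
    linarith
  have hleast : ∀ x ∈ P.feasible, IsMinOn P.f P.feasible x → P.fStar = P.f x := by
    intro x hx hx'
    refine IsLeast.csInf_eq ⟨⟨x, hx, rfl⟩, ?_⟩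
    rintro _ ⟨y, hy, rfl⟩
    exact hx' hy
  obtain ⟨h1, h2⟩ := argminOn_spec ⟨_, hfeas, hmin⟩
  exact ⟨by rw [hleast _ hfeas hmin, hval, dStar_eq hus], h1, (hleast _ h1 h2).symm⟩

/-- Quadratic growth of `𝓛(·, u)` at `x̄(u)` is evaluated at `x⋆`, where feasibility gives `𝓛(x⋆, u)
≤ f⋆ = d⋆`. -/
theorem norm_xBar_sub_xStar_le (hP : P.BasicAssumptions) (hut : P.ConstraintAssumptions ut)
    (hus : us ∈ P.dualOptimal) (hu : u ∈ dualFeasible m p) {E : ℝ}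
    (hE : P.dStar - P.dual u ≤ E) : ‖P.xBar u - P.xStar‖ ≤ √(2 * P.θ⁻¹ * E) := by
  obtain ⟨h1, h2, h3⟩ := strong_duality hP hut hus
  have hu' := dualFeasible_subset_ext hut.ut_neg hu
  obtain ⟨hx, hm⟩ := xBar_spec hP hut hu'
  have h4 := StrongConvexOn.quadratic_growth (hP.strongConvexOn_lagrangian_of_mem hu) hx hm h2.1
  have h5 := inner_constr_nonpos_of_feasible h2 hu
  rw [← dual_eq hP hut hu', lagrangian_eq] at h4
  have h6 : P.θ / 2 * ‖P.xBar u - P.xStar‖ ^ 2 ≤ E := by linarith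
  refine Real.le_sqrt_of_sq_le ?_
  have hθ := hP.theta_pos
  have h7 := mul_le_mul_of_nonneg_left h6 (by positivity : 0 ≤ 2 * P.θ⁻¹)
  refine le_trans (le_of_eq ?_) h7
  field_simp

theorem infeas_nonneg (x : Vec n) : 0 ≤ P.infeas x := Real.sqrt_nonneg _

theorem infeas_sq (x : Vec n) :
    P.infeas x ^ 2 = ∑ i, max 0 (P.g i x) ^ 2 + ∑ j, P.eqRes x j ^ 2 := by
  rw [infeas, Real.sq_sqrt (add_nonneg (sq_nonneg _) (Finset.sum_nonneg fun i _ => sq_nonneg _)),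
    add_comm]
  simp [EuclideanSpace.norm_sq_eq]

theorem inner_constr_le_norm_mul_infeas (hu : u ∈ dualFeasible m p) (x : Vec n) :
    ⟪u, P.constr x⟫_ℝ ≤ ‖u‖ * P.infeas x := by
  set w : DualVec m p := WithLp.toLp 2 (Sum.elim (fun i => max 0 (P.g i x)) fun j => P.eqRes x j)
    with hw
  have h1 : ⟪u, P.constr x⟫_ℝ ≤ ⟪u, w⟫_ℝ := by
    rw [dual_inner_eq, dual_inner_eq]
    exact add_le_add (Finset.sum_le_sum fun i _ =>
      mul_le_mul_of_nonneg_left (le_max_right _ _) (hu i)) le_rfl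
  have h2 : ‖w‖ = P.infeas x := by
    refine (sq_eq_sq₀ (norm_nonneg _) (infeas_nonneg _)).1 ?_
    rw [infeas_sq, dual_norm_sq]
    rfl
  rw [← h2]
  exact h1.trans (real_inner_le_norm _ _)

/-- Consequences of a projected gradient step of length `1 / L` for the primal point `x̄(u)`. -/
theorem primal_estimates (hP : P.BasicAssumptions) (hut : P.ConstraintAssumptions ut)
    (hus : us ∈ P.dualOptimal) (hu : u ∈ dualFeasible m p) {L E : ℝ} (hL : 0 < L)
    (hγ : P.gamma u * P.constrLip ≤ L) (hE : P.dStar - P.dual u ≤ E) :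
    P.infeas (P.xBar u) ≤ √(2 * L * E) ∧
      P.f (P.xBar u) - P.fStar ≤ ‖u‖ * √(2 * L * E) ∧
      -(‖us‖ * √(2 * L * E)) ≤ P.f (P.xBar u) - P.fStar := by
  have hu' := dualFeasible_subset_ext hut.ut_neg hu
  have hus' := dualFeasible_subset_ext hut.ut_neg hus.1
  set a := P.constr (P.xBar u) with ha
  set v := clip (u + L⁻¹ • a) with hv
  set h := v - u with hh
  have hstep := dual_ge_of_mem hP hut hu (clip_mem (u + L⁻¹ • a)) hγ
  rw [← hv, ← hh, ← ha] at hstep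
  have hvs : P.dual v ≤ P.dStar := by
    rw [dStar_eq hus]
    exact hus.2 (clip_mem _)
  have hi : ∀ i, h (Sum.inl i) = max 0 (u (Sum.inl i) + L⁻¹ * a (Sum.inl i)) - u (Sum.inl i) :=
    fun i => rfl
  have hj : ∀ j, a (Sum.inr j) = L * h (Sum.inr j) := fun j => by
    simp [hh, hv, mul_inv_cancel_left₀ hL.ne']
  -- `q` is the increase guaranteed by the quadratic model; it cannot exceed the dual gap, and it
  -- splits over coordinates.
  set q := ⟪a, h⟫_ℝ - L / 2 * ‖h‖ ^ 2 with hq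
  have hqE : q ≤ P.dStar - P.dual u := by linarith
  have hqe : q = ∑ i, (a (Sum.inl i) * h (Sum.inl i) - L / 2 * h (Sum.inl i) ^ 2) +
      ∑ j, (a (Sum.inr j) * h (Sum.inr j) - L / 2 * h (Sum.inr j) ^ 2) := by
    rw [hq, dual_inner_eq, dual_norm_sq]
    simp only [Finset.sum_sub_distrib, Finset.mul_sum, mul_add]
    ring
  have q1 : L / 2 * ‖h‖ ^ 2 ≤ q := by
    rw [hqe, dual_norm_sq, mul_add, Finset.mul_sum, Finset.mul_sum]
    refine add_le_add (Finset.sum_le_sum fun i _ => (clip_step_estimates hL (hu i) (hi i)).1)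
      (Finset.sum_le_sum fun j _ => le_of_eq ?_)
    rw [hj]
    ring
  have q2 : P.infeas (P.xBar u) ^ 2 ≤ 2 * L * q := by
    rw [hqe, infeas_sq, mul_add, Finset.mul_sum, Finset.mul_sum]
    refine add_le_add (Finset.sum_le_sum fun i _ => (clip_step_estimates hL (hu i) (hi i)).2.1)
      (Finset.sum_le_sum fun j _ => le_of_eq ?_)
    have : P.eqRes (P.xBar u) j = L * h (Sum.inr j) := hj j
    rw [hj, this]
    ring
  have q3 : -⟪u, a⟫_ℝ ≤ q - L * ⟪u, h⟫_ℝ := by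
    rw [hqe, dual_inner_eq, dual_inner_eq, mul_add, Finset.mul_sum, Finset.mul_sum, neg_add,
      add_sub_add_comm, ← Finset.sum_neg_distrib, ← Finset.sum_neg_distrib,
      ← Finset.sum_sub_distrib, ← Finset.sum_sub_distrib]
    refine add_le_add (Finset.sum_le_sum fun i _ => (clip_step_estimates hL (hu i) (hi i)).2.2)
      (Finset.sum_le_sum fun j _ => ?_)
    rw [hj]
    have : 0 ≤ L * h (Sum.inr j) ^ 2 := by positivity
    linarith
  have hLE : 2 * L * q ≤ 2 * L * E :=
    mul_le_mul_of_nonneg_left (hqE.trans hE) (by positivity)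
  have r1 : P.infeas (P.xBar u) ≤ √(2 * L * E) := Real.le_sqrt_of_sq_le (q2.trans hLE)
  have r2 : L * ‖h‖ ≤ √(2 * L * E) := by
    refine Real.le_sqrt_of_sq_le (le_trans ?_ hLE)
    have := mul_le_mul_of_nonneg_left q1 hL.le
    linarith
  have hfs := (strong_duality hP hut hus).1
  refine ⟨r1, ?_, ?_⟩
  -- Here `f(x̄(u)) - f⋆` equals `-⟪u, a⟫` minus the dual gap. The `q` in `q3` is absorbed by that
  -- gap, leaving only `-L⟪u, h⟫`.
  · have h1 := dual_eq hP hut hu'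
    rw [lagrangian_eq, ← ha] at h1
    have h2 := (abs_le.1 (abs_real_inner_le_norm u h)).1
    have h3 := mul_le_mul_of_nonneg_left h2 hL.le
    have h4 := mul_le_mul_of_nonneg_left r2 (norm_nonneg u)
    linarith
  · have h1 := dual_le hP hut hus' (xBar_spec hP hut hu').1
    rw [lagrangian_eq, ← dStar_eq hus] at h1
    have h2 := inner_constr_le_norm_mul_infeas (P := P) hus.1 (P.xBar u)
    have h3 := mul_le_mul_of_nonneg_left r1 (norm_nonneg us)
    linarith

theorem clip_fixed_of_dualOptimal (hP : P.BasicAssumptions) (hut : P.ConstraintAssumptions ut)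
    (hus : us ∈ P.dualOptimal) {α : ℝ} (hα : 0 ≤ α) :
    clip (us + α • P.gradDual us) = us := by
  set c := clip (us + α • P.gradDual us) with hc
  have h1 := inner_sub_clip_le (us + α • P.gradDual us) hus.1
  have h2 := inner_constr_le_of_dualOptimal hP hut hus (clip_mem (us + α • P.gradDual us))
  rw [← gradDual_eq hP hut hus.1, ← hc] at h2
  rw [← hc, show us + α • P.gradDual us - c = (us - c) + α • P.gradDual us by abel,
    inner_add_left, real_inner_self_eq_norm_sq, inner_smul_left, ← neg_sub c us,
    inner_neg_right, norm_neg] at h1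
  have h3 := mul_nonpos_of_nonneg_of_nonpos hα h2
  have h4 : ‖c - us‖ ^ 2 ≤ 0 := by
    simp only [conj_trivial] at h1
    linarith
  exact sub_eq_zero.1 (norm_eq_zero.1
    (pow_eq_zero_iff two_ne_zero |>.1 (le_antisymm h4 (sq_nonneg _))))

/-- A gradient projection step with an admissible step-size does not increase the distance to a
dual solution. -/
theorem norm_clip_step_sub_le (hP : P.BasicAssumptions) (hut : P.ConstraintAssumptions ut)
    (hus : us ∈ P.dualOptimal) {α : ℝ} (hα : 0 ≤ α)
    (hco : α * ‖P.gradDual u - P.gradDual us‖ ^ 2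
      ≤ 2 * ⟪P.gradDual u - P.gradDual us, us - u⟫_ℝ) :
    ‖clip (u + α • P.gradDual u) - us‖ ≤ ‖u - us‖ := by
  conv_lhs => rw [← clip_fixed_of_dualOptimal hP hut hus hα]
  refine (norm_clip_sub_clip_le _ _).trans (le_of_sq_le_sq ?_ (norm_nonneg _))
  rw [show u + α • P.gradDual u - (us + α • P.gradDual us)
    = (u - us) + α • (P.gradDual u - P.gradDual us) by module, norm_add_sq_real,
    inner_smul_right, norm_smul, mul_pow, Real.norm_eq_abs, sq_abs, real_inner_comm,
    ← neg_sub us u, inner_neg_right, norm_neg]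
  have := mul_le_mul_of_nonneg_left hco hα
  linarith

/-- The obtuse-angle inequality at `u` turns the linear term of the quadratic model into at least
`‖c - u‖²/α`, where `c` is the new point. -/
theorem dual_clip_step_ge (hP : P.BasicAssumptions) (hut : P.ConstraintAssumptions ut)
    (hu : u ∈ dualFeasible m p) {α L : ℝ} (hα : 0 < α) (hL : P.gamma u * P.constrLip ≤ L) :
    P.dual u + (1 / α - L / 2) * ‖clip (u + α • P.gradDual u) - u‖ ^ 2
      ≤ P.dual (clip (u + α • P.gradDual u)) := by
  have h1 := dual_ge_of_mem hP hut hu (clip_mem (u + α • P.gradDual u)) hL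
  have h2 := inner_sub_clip_le (u + α • P.gradDual u) hu
  rw [← gradDual_eq hP hut hu] at h1
  set c := clip (u + α • P.gradDual u)
  rw [show u + α • P.gradDual u - c = (u - c) + α • P.gradDual u by abel,
    inner_add_left, real_inner_self_eq_norm_sq, inner_smul_left, ← neg_sub c u,
    inner_neg_right, norm_neg] at h2
  simp only [conj_trivial] at h2
  have h3 : 1 / α * ‖c - u‖ ^ 2 ≤ ⟪P.gradDual u, c - u⟫_ℝ := by
    rw [one_div_mul_eq_div, div_le_iff₀ hα]
    linarith
  linarith

/-- By concavity the gap is at most `⟪∇d(u), us - u⟫`, split at the new point `c`: Cauchy–Schwarz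
bounds the part along `c - u`, and the obtuse-angle inequality at `us` bounds the part along `us -
c`. -/
theorem dStar_sub_le_mul_norm_clip_step (hP : P.BasicAssumptions)
    (hut : P.ConstraintAssumptions ut) (hus : us ∈ P.dualOptimal) (hu : u ∈ dualFeasible m p)
    {α G r : ℝ} (hα : 0 < α) (hG : ‖P.gradDual u‖ ≤ G)
    (hr : ‖clip (u + α • P.gradDual u) - us‖ ≤ r) :
    P.dStar - P.dual u ≤ (G + r / α) * ‖clip (u + α • P.gradDual u) - u‖ := by
  have h1 := dual_le_add_inner hP hut (dualFeasible_subset_ext hut.ut_neg hu)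
    (dualFeasible_subset_ext hut.ut_neg hus.1)
  have h2 := inner_sub_clip_le (u + α • P.gradDual u) hus.1
  rw [← gradDual_eq hP hut hu, ← dStar_eq hus] at h1
  set c := clip (u + α • P.gradDual u)
  rw [show u + α • P.gradDual u - c = (u - c) + α • P.gradDual u by abel,
    inner_add_left, inner_smul_left] at h2
  simp only [conj_trivial] at h2
  have h3 : -⟪u - c, us - c⟫_ℝ ≤ ‖c - u‖ * r := by
    rw [← inner_neg_left, neg_sub]
    refine (real_inner_le_norm _ _).trans (mul_le_mul_of_nonneg_left ?_ (norm_nonneg _))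
    rwa [norm_sub_rev]
  have h4 : ⟪P.gradDual u, us - c⟫_ℝ ≤ r / α * ‖c - u‖ := by
    rw [div_mul_eq_mul_div, le_div_iff₀ hα]
    linarith
  have h5 : ⟪P.gradDual u, c - u⟫_ℝ ≤ G * ‖c - u‖ :=
    (real_inner_le_norm _ _).trans (mul_le_mul_of_nonneg_right hG (norm_nonneg _))
  have h6 : ⟪P.gradDual u, us - u⟫_ℝ = ⟪P.gradDual u, us - c⟫_ℝ + ⟪P.gradDual u, c - u⟫_ℝ := by
    rw [← inner_add_right, sub_add_sub_cancel]
  linarith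

end Problem

end DualAscent

/-! ### Assembly of the convergence theorem -/

open DualAscent in
theorem mainTheorem1 {n m p : ℕ} (P : Problem n m p) (hP : P.BasicAssumptions)
    (hγ : ∀ u ∈ dualFeasible m p, 0 < P.gamma u)
    (ut : DualVec m p) (hut : P.ConstraintAssumptions ut)
    (us : DualVec m p) (hus : us ∈ P.dualOptimal)
    (u₀ : DualVec m p) (hu₀ : u₀ ∈ dualFeasible m p)
    (D₀ : Set (DualVec m p))
    (hD₀ : D₀ = {u | u ∈ dualFeasible m p ∧ ‖u - us‖ ≤ ‖u₀ - us‖})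
    (LΦ LΨ R₀ : ℝ) (hLΦ : LΦ = P.lipConst (P.Phi D₀)) (hLΨ : LΨ = P.lipConst (P.Psi ut D₀))
    (hR₀ : R₀ = P.dStar - P.dual u₀) :
    -- all the quantities involved are well defined and finite
    ((∀ u ∈ dualFeasible m p, DifferentiableAt ℝ P.dual u) ∧
      P.Phi D₀ ⊆ dualFeasible m p ∧ P.Psi ut D₀ ⊆ dualFeasibleExt ut ∧
      BddAbove (P.gamma '' P.Phi D₀) ∧ 0 < LΦ ∧
      BddAbove (P.gamma '' P.Psi ut D₀) ∧ 0 < LΨ ∧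
      BddAbove (P.etaQuotients ut D₀) ∧ 0 ≤ P.eta ut D₀ ∧
      BddAbove ((fun u => ‖P.gradDual u‖) '' D₀) ∧
      0 ≤ R₀ ∧ (u₀ ∉ P.dualOptimal → 0 < R₀)) ∧
    -- convergence rates for every admissible step-size
    ∀ (α : ℝ) (u : ℕ → DualVec m p),
      0 < α → α < P.stepBound ut D₀ →
      u 0 = u₀ →
      (∀ k, u (k + 1) = proj (dualFeasible m p) (u k + α • P.gradDual (u k))) →
      ∀ (ρ δ : ℝ), ρ = (sSup ((fun u => ‖P.gradDual u‖) '' D₀) + ‖u₀ - us‖ / α) ^ 2 →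
      δ = 1 / α - LΨ / 2 →
      0 < δ ∧ (u₀ ∉ P.dualOptimal → 0 < ρ) ∧
      ∀ k : ℕ,
        P.dStar - P.dual (u k) ≤ R₀ / (1 + k * R₀ * δ * ρ⁻¹) ∧
        ‖P.xBar (u k) - P.xStar‖ ≤ √(2 * R₀ * P.θ⁻¹ / (1 + k * R₀ * δ * ρ⁻¹)) ∧
        P.f (P.xBar (u k)) - P.fStar ≤
          (‖us‖ + ‖u₀ - us‖) * √(2 * (m + p) * LΦ * R₀ / (1 + k * R₀ * δ * ρ⁻¹)) +
            R₀ / (1 + k * R₀ * δ * ρ⁻¹) ∧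
        -(‖us‖ * √(2 * LΦ * R₀ / (1 + k * R₀ * δ * ρ⁻¹))) ≤ P.f (P.xBar (u k)) - P.fStar ∧
        P.infeas (P.xBar (u k)) ≤ √(2 * LΦ * R₀ / (1 + k * R₀ * δ * ρ⁻¹)) := by
  subst hLΦ hLΨ
  have hs : D₀ ⊆ dualFeasible m p := fun v hv => by
    rw [hD₀] at hv
    exact hv.1
  have hb : Bornology.IsBounded D₀ := (Metric.isBounded_closedBall (x := us)
    (r := ‖u₀ - us‖)).subset fun v hv => by
      rw [hD₀] at hv
      rw [Metric.mem_closedBall, dist_eq_norm]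
      exact hv.2
  have hu₀D : u₀ ∈ D₀ := by
    rw [hD₀]
    exact ⟨hu₀, le_rfl⟩
  have husD : us ∈ D₀ := by
    rw [hD₀]
    exact ⟨hus.1, by simp⟩
  have hsub := dualFeasible_subset_ext hut.ut_neg
  have hq := Problem.bddAbove_etaQuotients hP hut hs hb
  have hΨ := Problem.Psi_subset hut hs hq
  have hΦ : P.Phi D₀ ⊆ dualFeasible m p := Problem.Phi_subset
  have hΦb := Problem.bddAbove_gamma hP hut (hΦ.trans hsub) (Problem.isBounded_Phi hP hut hs hb)
  have hΨb := Problem.bddAbove_gamma hP hut hΨ (Problem.isBounded_Psi hP hut hs hb)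
  have hDΦ := Problem.subset_Phi (P := P) hP.theta_pos hs
  have hDΨ := Problem.subset_Psi (P := P) (ut := ut) (S := D₀)
  have hΦ0 := Problem.lipConst_pos hP hΦb (hDΦ hu₀D) (hγ u₀ hu₀)
  have hΨ0 := Problem.lipConst_pos hP hΨb (hDΨ hu₀D) (hγ u₀ hu₀)
  have hGb : BddAbove ((fun u => ‖P.gradDual u‖) '' D₀) := by
    obtain ⟨G, hG⟩ := Problem.exists_norm_gradDual_le hP hut hs hb
    refine ⟨G, ?_⟩
    rintro _ ⟨v, hv, rfl⟩
    exact hG v hv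
  have hds := Problem.dStar_eq hus
  have hle : ∀ v ∈ dualFeasible m p, 0 ≤ P.dStar - P.dual v := fun v hv => by
    rw [hds]
    exact sub_nonneg.2 (hus.2 hv)
  have hR0 : 0 ≤ R₀ := hR₀ ▸ hle u₀ hu₀
  have hRpos : u₀ ∉ P.dualOptimal → 0 < R₀ := by
    intro hno
    refine hR0.lt_of_ne fun h0 => hno ⟨hu₀, fun v hv => ?_⟩
    have h1 := hle v hv
    change P.dual v ≤ P.dual u₀
    linarith
  refine ⟨⟨fun v hv => (Problem.hasGradientAt_dual hP hut hv).differentiableAt, hΦ, hΨ, hΦb, hΦ0,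
    hΨb, hΨ0, hq, Problem.eta_nonneg hP.theta_pos, hGb, hR0, hRpos⟩, ?_⟩
  intro α u hα hαs hu0 hstep ρ δ hρ hδ
  simp only [proj_eq_clip] at hstep
  have hδ0 : 0 < δ := by
    have h1 := hαs.trans_le (Problem.stepBound_le hΨ0)
    rw [lt_div_iff₀ hΨ0] at h1
    have h2 : P.lipConst (P.Psi ut D₀) / 2 < 1 / α := by
      rw [lt_div_iff₀ hα]
      linarith
    linarith
  set G := sSup ((fun u => ‖P.gradDual u‖) '' D₀) with hGdef
  have hG : ∀ v ∈ D₀, ‖P.gradDual v‖ ≤ G := fun v hv => le_csSup hGb ⟨v, hv, rfl⟩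
  -- Since `us` itself lies in `D₀`, cocoercivity on `D₀` applies to the pair `(u k, us)`;
  -- membership thus propagates and all constants of `D₀` remain available.
  have hmem : ∀ k, u k ∈ D₀ := by
    intro k
    induction k with
    | zero => exact hu0 ▸ hu₀D
    | succ k ih =>
      have h1 := Problem.norm_clip_step_sub_le hP hut hus hα.le
        (Problem.gradDual_cocoercive hP hut hs hb hΨ0 ih husD hαs.le)
      rw [← hstep] at h1
      have h2 : u (k + 1) ∈ dualFeasible m p := hstep k ▸ clip_mem _
      rw [hD₀] at ih ⊢
      exact ⟨h2, h1.trans ih.2⟩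
  have hdist : ∀ k, ‖u k - us‖ ≤ ‖u₀ - us‖ := fun k => by
    have := hmem k
    rw [hD₀] at this
    exact this.2
  have hsq : ∀ k, (P.dStar - P.dual (u k)) ^ 2 ≤ ρ * ‖u (k + 1) - u k‖ ^ 2 := by
    intro k
    have h1 := Problem.dStar_sub_le_mul_norm_clip_step hP hut hus (hs (hmem k)) hα
      (hG _ (hmem k)) (r := ‖u₀ - us‖) (by rw [← hstep]; exact hdist (k + 1))
    rw [← hstep] at h1
    rw [hρ, ← mul_pow]
    exact pow_le_pow_left₀ (hle _ (hs (hmem k))) h1 2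
  have hρ0 : 0 ≤ ρ := hρ ▸ sq_nonneg _
  have hdec : ∀ k, P.dStar - P.dual (u (k + 1)) ≤
      P.dStar - P.dual (u k) - δ * ρ⁻¹ * (P.dStar - P.dual (u k)) ^ 2 := by
    intro k
    have h1 := Problem.dual_clip_step_ge hP hut (hs (hmem k)) hα
      (Problem.gamma_mul_constrLip_le hΨb (hDΨ (hmem k)))
    rw [← hstep, ← hδ] at h1
    have h2 : ρ⁻¹ * (P.dStar - P.dual (u k)) ^ 2 ≤ ‖u (k + 1) - u k‖ ^ 2 := by
      -- If `ρ = 0`, then `ρ⁻¹ = 0` by convention and the bound is trivial.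
      rcases hρ0.eq_or_lt with h0 | h0
      · rw [← h0, inv_zero, zero_mul]
        exact sq_nonneg _
      · rw [inv_mul_le_iff₀ h0]
        exact hsq k
    have h3 := mul_le_mul_of_nonneg_left h2 hδ0.le
    linarith
  refine ⟨hδ0, fun hno => ?_, fun k => ?_⟩
  · have h1 := hsq 0
    rw [hu0, ← hR₀] at h1
    have h2 := pow_pos (hRpos hno) 2
    exact pos_of_mul_pos_left (h2.trans_le h1) (sq_nonneg _)
  have hrate := le_div_of_quadratic_decrease (e := fun k => P.dStar - P.dual (u k))
    (mul_nonneg hδ0.le (inv_nonneg.2 hρ0)) (fun k => hle _ (hs (hmem k))) hdec k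
  simp only [hu0, ← hR₀, ← mul_assoc] at hrate
  set E := R₀ / (1 + k * R₀ * δ * ρ⁻¹) with hE
  have hE0 : 0 ≤ E := (hle _ (hs (hmem k))).trans hrate
  obtain ⟨h1, h2, h3⟩ := Problem.primal_estimates hP hut hus (hs (hmem k)) hΦ0
    (Problem.gamma_mul_constrLip_le hΦb (hDΦ (hmem k))) hrate
  have h4 := Problem.norm_xBar_sub_xStar_le hP hut hus (hs (hmem k)) hrate
  simp only [mul_right_comm _ R₀ P.θ⁻¹, mul_div_assoc _ R₀, ← hE]
  refine ⟨hrate, h4, ?_, h3, h1⟩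
  have hn : ‖u k‖ ≤ ‖us‖ + ‖u₀ - us‖ := by
    have h5 := norm_add_le us (u k - us)
    rw [add_sub_cancel] at h5
    linarith [hdist k]
  -- The estimate `h2` has neither the factor `m + p` nor the term `E`; `m + p ≥ 1` and `E ≥ 0`
  -- weaken it to the stated bound.
  have hmp : (1 : ℝ) ≤ m + p := by
    have := Nat.one_le_iff_ne_zero.2 hP.exists_constraint
    exact_mod_cast this
  have hsqrt : √(2 * P.lipConst (P.Phi D₀) * E) ≤ √(2 * (m + p) * P.lipConst (P.Phi D₀) * E) := by
    refine Real.sqrt_le_sqrt (mul_le_mul_of_nonneg_right ?_ hE0)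
    refine mul_le_mul_of_nonneg_right ?_ hΦ0.le
    linarith
  have h6 := mul_le_mul hn hsqrt (Real.sqrt_nonneg _) (by positivity)
  linarith
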